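/- **Conventions.** "Recursively enumerable" (r.e.) and "algorithm" refer to partial recursive functions, through effective codings of finite objects. A real $x$ is *lower* (resp. *upper*) *semi-computable* if $\{q\in\mathbb Q: q<x\}$ (resp. $\{q\in\mathbb Q: q>x\}$) is r.e., and *computable* if it is both. A *computable metric space* $(X,d,S)$ is a complete separable metric space with a dense sequence $S=(s_i)_{i\in\mathbb N}$ of *ideal points* such that the reals $d(s_i,s_j)$ are computable uniformly in $i,j$. In a metric space with a numbered family of ideal points, an *ideal ball* is an open ball $B(s,q)$ with $s$ an ideal point and $q\in\mathbb Q_{>0}$. A subset $C$ is *recursively compact* if it is compact and there is an algorithm which, given a finite list of (names of) ideal balls, halts if and only if these balls cover $C$. For a bounded computable metric space $X$, let $PM(X)$ be the set of Borel probability measures on $X$ with the distance $$W_1(\mu,\nu)=\sup_{f\ 1\text{-Lipschitz}}\Big|\int f\,d\mu-\int f\,d\nu\Big|,$$ whose ideal points are the finite rational convex combinations of Dirac measures at ideal points of $X$, with their natural numbering. For $\alpha\in\mathbb R$ and $\mu\in PM(X)$ let $$\|\mu\|_\alpha=\sup_{x\in X,\ r>0}\frac{\mu(B(x,r))}{r^\alpha}\in[0,\infty],$$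 where $B(x,r)$ is the open ball. **Proposition.** Let $(X,d,S)$ be a computable metric space such that $X$ is recursively compact (as a subset of itself). Let $\alpha$ be a computable real and let $K$ be an upper semi-computable real (for example, any computable real). Then $$V_{\alpha,K}=\{\mu\in PM(X):\ \|\mu\|_\alpha\le K\}$$ is a recursively compact subset of $PM(X)$. -/

import Mathlib

namespace CompMeas

noncomputable section

open MeasureTheory Set
open scoped ENNReal NNReal

/-! ### Computable reals

Finite objects are named by elements of types carrying Mathlib's effective coding `Primcodable`, and
`REPred` (the domain of a partial recursive function) is recursive enumerability. -/

/-- Effective numbering of the rationals: the triple `(a, b, c)` names `(a - b) / (c + 1)`. -/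
def rat (n : ℕ × ℕ × ℕ) : ℚ := ((n.1 : ℚ) - n.2.1) / (n.2.2 + 1)

/-- Effective numbering of the positive rationals: the pair `(a, b)` names `(a + 1) / (b + 1)`. -/
def posRat (n : ℕ × ℕ) : ℚ := ((n.1 : ℚ) + 1) / (n.2 + 1)

/-- The reals `x i` are lower semi-computable, uniformly in `i`: the sets `{q ∈ ℚ | q < x i}` are
recursively enumerable, uniformly in `i`. -/
def UnifLowerSemicomputable {ι : Type*} [Primcodable ι] (x : ι → ℝ) : Prop :=
  REPred fun p : ι × (ℕ × ℕ × ℕ) => (rat p.2 : ℝ) < x p.1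

/-- The reals `x i` are upper semi-computable, uniformly in `i`: the sets `{q ∈ ℚ | x i < q}` are
recursively enumerable, uniformly in `i`. -/
def UnifUpperSemicomputable {ι : Type*} [Primcodable ι] (x : ι → ℝ) : Prop :=
  REPred fun p : ι × (ℕ × ℕ × ℕ) => x p.1 < (rat p.2 : ℝ)

/-- The reals `x i` are computable, uniformly in `i`. -/
def UnifComputable {ι : Type*} [Primcodable ι] (x : ι → ℝ) : Prop :=
  UnifLowerSemicomputable x ∧ UnifUpperSemicomputable x

/-- The set `{q ∈ ℚ | q < x}` is recursively enumerable. -/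
def LowerSemicomputable (x : ℝ) : Prop :=
  REPred fun n : ℕ × ℕ × ℕ => (rat n : ℝ) < x

/-- The set `{q ∈ ℚ | x < q}` is recursively enumerable. -/
def UpperSemicomputable (x : ℝ) : Prop :=
  REPred fun n : ℕ × ℕ × ℕ => x < (rat n : ℝ)

/-- A real is computable if it is lower and upper semi-computable. -/
def ComputableReal (x : ℝ) : Prop :=
  LowerSemicomputable x ∧ UpperSemicomputable x

/-! ### Computable metric spaces and recursively compact sets -/

/-- `(X, d, s)` is a computable metric space: a complete metric space (separable because of the
second clause) with a dense numbered family `s` of ideal points whose mutual distances are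
computable, uniformly in the names. -/
structure IsComputableMetricSpace {X : Type*} [MetricSpace X] {ι : Type*} [Primcodable ι]
    (s : ι → X) : Prop where
  complete : CompleteSpace X
  dense : DenseRange s
  dist_computable : UnifComputable fun p : ι × ι => dist (s p.1) (s p.2)

/-- The ideal ball named by `(i, j)`: the open ball about the ideal point `s i` whose radius is the
positive rational named by `j`. -/
def idealBall {X : Type*} [MetricSpace X] {ι : Type*} (s : ι → X) (p : ι × (ℕ × ℕ)) : Set X :=
  Metric.ball (s p.1) (posRat p.2 : ℝ)

/-- `K` is recursively compact: it is compact, and there is an algorithm which, given a finite list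
of names of ideal balls, halts if and only if these balls cover `K`. -/
def IsRecursivelyCompact {X : Type*} [MetricSpace X] {ι : Type*} [Primcodable ι]
    (s : ι → X) (K : Set X) : Prop :=
  IsCompact K ∧ REPred fun L : List (ι × (ℕ × ℕ)) => K ⊆ ⋃ p ∈ L, idealBall s p

/-! ### The space of Borel probability measures with the Wasserstein–Kantorovich distance -/

/-- The Borel probability measures on `X`. This is a separate type so that it carries the metric
`W₁` below (and the topology of that metric). -/
structure PM (X : Type*) [MeasurableSpace X] where
  /-- the underlying measure -/
  toMeasure : Measure X
  /-- it has total mass one -/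
  isProb : IsProbabilityMeasure toMeasure

attribute [instance] PM.isProb

/-- `W₁(μ, ν)`, the supremum of `|∫ f dμ - ∫ f dν|` over all 1-Lipschitz `f : X → ℝ`. -/
def W1 {X : Type*} [MetricSpace X] [MeasurableSpace X] (μ ν : PM X) : ℝ :=
  ⨆ f : {f : X → ℝ // LipschitzWith 1 f}, |∫ x, f.1 x ∂μ.toMeasure - ∫ x, f.1 x ∂ν.toMeasure|

theorem abs_sub_le_diam {X : Type*} [MetricSpace X] [BoundedSpace X] {f : X → ℝ}
    (hf : LipschitzWith 1 f) (x y : X) :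
    |f x - f y| ≤ Metric.diam (univ : Set X) := by
  have h := hf.dist_le_mul x y
  rw [Real.dist_eq] at h
  have h2 := Metric.dist_le_diam_of_mem (Bornology.IsBounded.all (univ : Set X))
    (mem_univ x) (mem_univ y)
  simp at h
  linarith

section Metric

variable {X : Type*} [MetricSpace X] [BoundedSpace X] [MeasurableSpace X] [BorelSpace X]

theorem integrable_of_lipschitz {f : X → ℝ} (hf : LipschitzWith 1 f) (μ : PM X) :
    Integrable f μ.toMeasure := by
  obtain ⟨x₀⟩ : Nonempty X := nonempty_of_isProbabilityMeasure μ.toMeasure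
  refine Integrable.of_bound (C := |f x₀| + Metric.diam (univ : Set X))
    hf.continuous.measurable.aestronglyMeasurable (Filter.Eventually.of_forall fun x => ?_)
  have h := abs_sub_le_diam hf x x₀
  rw [Real.norm_eq_abs]
  have := abs_sub_abs_le_abs_sub (f x) (f x₀)
  linarith

theorem W1_bddAbove (μ ν : PM X) :
    BddAbove (range fun f : {f : X → ℝ // LipschitzWith 1 f} =>
      |∫ x, f.1 x ∂μ.toMeasure - ∫ x, f.1 x ∂ν.toMeasure|) := by
  obtain ⟨x₀⟩ : Nonempty X := nonempty_of_isProbabilityMeasure μ.toMeasure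
  refine ⟨Metric.diam (univ : Set X) + Metric.diam (univ : Set X), ?_⟩
  rintro _ ⟨⟨f, hf⟩, rfl⟩
  have key : ∀ ρ : PM X, |∫ x, f x ∂ρ.toMeasure - f x₀| ≤ Metric.diam (univ : Set X) := by
    intro ρ
    have h1 : ∫ x, f x ∂ρ.toMeasure - f x₀ = ∫ x, (f x - f x₀) ∂ρ.toMeasure := by
      rw [integral_sub (integrable_of_lipschitz hf ρ) (integrable_const _)]
      simp
    rw [h1, ← Real.norm_eq_abs]
    refine (norm_integral_le_of_norm_le_const (C := Metric.diam (univ : Set X))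
      (Filter.Eventually.of_forall fun x => ?_)).trans ?_
    · exact abs_sub_le_diam hf x x₀
    · simp
  have h := abs_sub_le (∫ x, f x ∂μ.toMeasure) (f x₀) (∫ x, f x ∂ν.toMeasure)
  have h2 := key ν
  rw [abs_sub_comm] at h2
  have h1 := key μ
  simp only
  linarith

theorem le_W1 (μ ν : PM X) {f : X → ℝ} (hf : LipschitzWith 1 f) :
    |∫ x, f x ∂μ.toMeasure - ∫ x, f x ∂ν.toMeasure| ≤ W1 μ ν :=
  le_ciSup (W1_bddAbove μ ν) ⟨f, hf⟩

instance : Nonempty {f : X → ℝ // LipschitzWith 1 f} :=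
  ⟨⟨fun _ => 0, LipschitzWith.const' 0⟩⟩

theorem eq_of_W1_eq_zero {μ ν : PM X} (h : W1 μ ν = 0) : μ = ν := by
  have h1 : ∀ f : X → ℝ, LipschitzWith 1 f →
      ∫ x, f x ∂μ.toMeasure = ∫ x, f x ∂ν.toMeasure := by
    intro f hf
    have := le_W1 μ ν hf
    rw [h] at this
    exact sub_eq_zero.1 (abs_eq_zero.1 (le_antisymm this (abs_nonneg _)))
  have h2 : ∀ (c : ℝ≥0) (f : X → ℝ), LipschitzWith c f →
      ∫ x, f x ∂μ.toMeasure = ∫ x, f x ∂ν.toMeasure := by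
    intro c f hf
    have hpos : (0 : ℝ) < (c : ℝ) + 1 := by positivity
    have hl : LipschitzWith 1 fun x => ((c : ℝ) + 1)⁻¹ * f x := by
      refine LipschitzWith.of_dist_le_mul fun x y => ?_
      have := hf.dist_le_mul x y
      rw [Real.dist_eq] at this ⊢
      rw [← mul_sub, abs_mul, abs_of_pos (inv_pos.2 hpos), inv_mul_le_iff₀ hpos]
      simp only [NNReal.coe_one, one_mul]
      nlinarith [dist_nonneg (x := x) (y := y)]
    have := h1 _ hl
    rw [integral_const_mul, integral_const_mul] at this
    exact mul_left_cancel₀ (inv_pos.2 hpos).ne' this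
  have hm : μ.toMeasure = ν.toMeasure := by
    refine ext_of_generate_finite {s : Set X | IsClosed s}
      (BorelSpace.measurable_eq.trans borel_eq_generateFrom_isClosed) isPiSystem_isClosed ?_ ?_
    · intro F hF
      have hδ : ∀ n : ℕ, (0 : ℝ) < 1 / ((n : ℝ) + 1) := fun n => by positivity
      have t1 := tendsto_integral_thickenedIndicator_of_isClosed μ.toMeasure hF hδ
        tendsto_one_div_add_atTop_nhds_zero_nat
      have t2 := tendsto_integral_thickenedIndicator_of_isClosed ν.toMeasure hF hδ
        tendsto_one_div_add_atTop_nhds_zero_nat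
      have he : ∀ n : ℕ, ∫ x, ((thickenedIndicator (hδ n) F x : ℝ≥0) : ℝ) ∂μ.toMeasure
          = ∫ x, ((thickenedIndicator (hδ n) F x : ℝ≥0) : ℝ) ∂ν.toMeasure := by
        intro n
        exact h2 _ _ (LipschitzWith.of_dist_le_mul fun x y =>
          (lipschitzWith_thickenedIndicator (hδ n) F).dist_le_mul x y)
      simp only [he] at t1
      have := tendsto_nhds_unique t1 t2
      exact (measureReal_eq_measureReal_iff).1 this
    · simp
  cases μ
  cases ν
  simp only at hm
  subst hm
  rfl

/-- The metric `W₁` on the probability measures of a bounded metric space. -/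
instance : MetricSpace (PM X) where
  dist := W1
  dist_self μ := by simp [W1]
  dist_comm μ ν := by simp [W1, abs_sub_comm]
  dist_triangle μ ν ρ := by
    refine ciSup_le fun f => ?_
    exact (abs_sub_le _ (∫ x, f.1 x ∂ν.toMeasure) _).trans
      (add_le_add (le_W1 μ ν f.2) (le_W1 ν ρ f.2))
  eq_of_dist_eq_zero := eq_of_W1_eq_zero

end Metric

/-- Names of finite rational convex combinations of Dirac masses at ideal points. The nonempty list
`p :: L` of pairs `(w, i)` gives the ideal point `s i` a weight proportional to `w + 1`. -/
abbrev CombName : Type := (ℕ × ℕ) × List (ℕ × ℕ)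

/-- The sum of the integer weights in a list of pairs `(w, i)`. -/
def totalWeight (l : List (ℕ × ℕ)) : ℕ := (l.map fun p => p.1 + 1).sum

/-- The measure `∑ ((w + 1) / W) δ_{s i}`, the sum running over the pairs `(w, i)` in the list. -/
def diracSum {X : Type*} [MeasurableSpace X] (s : ℕ → X) (W : ℕ) (l : List (ℕ × ℕ)) : Measure X :=
  (l.map fun p => (((p.1 + 1 : ℕ) : ℝ≥0∞) / (W : ℝ≥0∞)) • Measure.dirac (s p.2)).sum

theorem diracSum_univ {X : Type*} [MeasurableSpace X] (s : ℕ → X) (W : ℕ) (l : List (ℕ × ℕ)) :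
    diracSum s W l univ = (totalWeight l : ℝ≥0∞) / W := by
  induction l with
  | nil => simp [diracSum, totalWeight]
  | cons p l ih =>
    have h1 : diracSum s W (p :: l) =
        (((p.1 + 1 : ℕ) : ℝ≥0∞) / (W : ℝ≥0∞)) • Measure.dirac (s p.2) + diracSum s W l := by
      simp [diracSum]
    have h2 : totalWeight (p :: l) = (p.1 + 1) + totalWeight l := by
      simp [totalWeight]
    rw [h1, h2, Measure.add_apply, ih, Measure.smul_apply, Nat.cast_add (p.1 + 1), ENNReal.add_div]
    simp

/-- The numbered family of ideal points of `PM X`: all finite rational convex combinations of Dirac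
masses at ideal points of `X`. -/
def idealMeasure {X : Type*} [MeasurableSpace X] (s : ℕ → X) (n : CombName) : PM X where
  toMeasure := diracSum s (totalWeight (n.1 :: n.2)) (n.1 :: n.2)
  isProb := ⟨by
    rw [diracSum_univ]
    refine ENNReal.div_self ?_ (ENNReal.natCast_ne_top _)
    simp [totalWeight]⟩

/-! ### Regular measures -/

/-- `‖μ‖_α`, the supremum of `μ (B(x, r)) / r ^ α` over all `x ∈ X` and all real `r > 0`. -/
def alphaNorm {X : Type*} [MetricSpace X] [MeasurableSpace X] (α : ℝ) (μ : PM X) : ℝ≥0∞ :=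
  ⨆ (x : X) (r : ℝ) (_ : 0 < r), μ.toMeasure (Metric.ball x r) / ENNReal.ofReal (r ^ α)

/-- `V_{α,K}`, the set of the probability measures `μ` with `‖μ‖_α ≤ K`. -/
def V (X : Type*) [MetricSpace X] [MeasurableSpace X] (α K : ℝ) : Set (PM X) :=
  {μ | (alphaNorm α μ : EReal) ≤ (K : EReal)}

end

end CompMeas

namespace CompMeas

/-! ### Closure properties of recursively enumerable predicates -/

section RE

variable {α β : Type*} [Primcodable α] [Primcodable β]

/-! Compactness: a measure is within `2ε` of a uniform measure on a tuple from a finite `ε`-net of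
`X` (`exists_uniformName_dist_le`), so `PM X` is totally bounded; weak compactness gives
completeness (`compactSpace_PM`). A ball carrying too much mass still does so, slightly enlarged,
for nearby measures (`real_ball_le`), so `V` is closed (`isClosed_V`) and hence compact.

Recursive compactness: search for a finite `ε`-net of `X`, which recursive compactness of `X`
recognises, and a tuple length for which each resulting uniform measure is either deep inside a
listed ball or certified far from `V`. Such a certificate is sound because the uniform measures form
a `2ε`-net of `PM X`. It exists whenever the balls cover `V`: otherwise bad ideal measures for `ε →
0` accumulate at some `μ` outside all the balls, hence outside `V`; an ideal ball violating the
bound for `μ` with room to spare then certifies nearby bad measures as far from `V`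
(`subset_iUnion_iff_exists_coverCertificate`).

The certificates are enumerable because strict upper bounds are: on `K * r ^ α`, by enclosing `α`
between rationals (`mul_rpow_lt_iff`), and on `W₁` between ideal measures, by testing finitely many
grid-valued functions (`dist_idealMeasure_lt_iff`). -/

/-- Run the program for `n` steps. Monotonicity in `n` lets finitely many halting computations share
one stage, which conjunctions and quantifiers over lists need. -/
theorem exists_primrecRel_of_rePred {p : α → Prop} (h : REPred p) :
    ∃ R : α → ℕ → Prop, PrimrecRel R ∧
      (∀ a m n, m ≤ n → R a m → R a n) ∧ ∀ a, p a ↔ ∃ n, R a n := by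
  obtain ⟨c, hc⟩ := Nat.Partrec.Code.exists_code.1 h
  refine ⟨fun a n => (c.evaln n (Encodable.encode a)).isSome = true, ?_, ?_, ?_⟩
  · refine Primrec₂.primrecRel (?_ : Primrec fun x : α × ℕ => _)
    have : Primrec fun x : α × ℕ => (c.evaln x.2 (Encodable.encode x.1)).isSome :=
      Primrec.option_isSome.comp (Nat.Partrec.Code.primrec_evaln.comp
        ((Primrec.snd.pair (Primrec.const c)).pair (Primrec.encode.comp Primrec.fst)))
    simpa using this
  · intro a m n hmn h
    obtain ⟨x, hx⟩ := Option.isSome_iff_exists.1 h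
    exact Option.isSome_iff_exists.2 ⟨x, Nat.Partrec.Code.evaln_mono hmn hx⟩
  · intro a
    have h1 : p a ↔ (c.eval (Encodable.encode a)).Dom := by
      rw [hc]
      simp [Part.assert, Part.bind]
    rw [h1, Part.dom_iff_mem]
    constructor
    · rintro ⟨x, hx⟩
      obtain ⟨k, hk⟩ := Nat.Partrec.Code.evaln_complete.1 hx
      exact ⟨k, Option.isSome_iff_exists.2 ⟨x, hk⟩⟩
    · rintro ⟨k, hk⟩
      obtain ⟨x, hx⟩ := Option.isSome_iff_exists.1 hk
      exact ⟨x, Nat.Partrec.Code.evaln_sound hx⟩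

theorem rePred_exists_of_primrecRel {R : α → ℕ → Prop} (hR : PrimrecRel R) :
    REPred fun a => ∃ n, R a n := by
  classical
  have h1 : Partrec fun a => Nat.rfind fun n => Part.some (decide (R a n)) :=
    Partrec.rfind (Computable.partrec (Primrec.to_comp hR.decide) :
      Partrec fun x : α × ℕ => Part.some (decide (R x.1 x.2)))
  refine h1.dom_re.of_eq fun a => ?_
  refine Nat.rfind_dom.trans ⟨fun ⟨n, hn, _⟩ => ⟨n, by simpa using hn⟩,
    fun ⟨n, hn⟩ => ⟨n, by simpa using hn, fun _ => trivial⟩⟩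

theorem rePred_of_primrecPred {p : α → Prop} (hp : PrimrecPred p) : REPred p := by
  obtain ⟨_, h⟩ := hp
  exact ComputablePred.to_re ⟨_, h.to_comp⟩

theorem rePred_comp {p : β → Prop} (hp : REPred p) {f : α → β} (hf : Primrec f) :
    REPred fun a => p (f a) :=
  Partrec.comp hp hf.to_comp

theorem rePred_and {p q : α → Prop} (hp : REPred p) (hq : REPred q) :
    REPred fun a => p a ∧ q a := by
  obtain ⟨R, hR, mR, h⟩ := exists_primrecRel_of_rePred hp
  obtain ⟨S, hS, mS, k⟩ := exists_primrecRel_of_rePred hq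
  refine (rePred_exists_of_primrecRel (R := fun a n => R a n ∧ S a n)
    (PrimrecPred.and hR hS)).of_eq fun a => ?_
  rw [h, k]
  constructor
  · rintro ⟨n, h1, h2⟩
    exact ⟨⟨n, h1⟩, ⟨n, h2⟩⟩
  · rintro ⟨⟨m, h1⟩, ⟨n, h2⟩⟩
    exact ⟨max m n, mR _ _ _ (le_max_left _ _) h1, mS _ _ _ (le_max_right _ _) h2⟩

theorem rePred_or {p q : α → Prop} (hp : REPred p) (hq : REPred q) :
    REPred fun a => p a ∨ q a := by
  obtain ⟨R, hR, -, h⟩ := exists_primrecRel_of_rePred hp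
  obtain ⟨S, hS, -, k⟩ := exists_primrecRel_of_rePred hq
  refine (rePred_exists_of_primrecRel (R := fun a n => R a n ∨ S a n)
    (PrimrecPred.or hR hS)).of_eq fun a => ?_
  rw [h, k, exists_or]

theorem rePred_exists {p : α → β → Prop} (hp : REPred fun x : α × β => p x.1 x.2) :
    REPred fun a => ∃ b, p a b := by
  obtain ⟨R, hR, mR, h⟩ := exists_primrecRel_of_rePred hp
  classical
  -- Dovetailing: `n` codes a stage together with a candidate witness; numbers that code no witness
  -- give `none`.
  have h1 : PrimrecRel fun (a : α) (n : ℕ) =>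
      (Option.map (fun b => decide (R (a, b) n.unpair.1))
        (Encodable.decode (α := β) n.unpair.2)) = some true := by
    refine Primrec.eq.comp (Primrec.option_map (Primrec.decode.comp
      (Primrec.snd.comp (Primrec.unpair.comp Primrec.snd))) ?_) (Primrec.const _)
    refine hR.decide.comp₂ ?_ ?_
    · exact Primrec.pair (Primrec.fst.comp Primrec.fst) Primrec.snd
    · exact Primrec.fst.comp (Primrec.unpair.comp (Primrec.snd.comp Primrec.fst))
  refine (rePred_exists_of_primrecRel h1).of_eq fun a => ?_
  constructor
  · rintro ⟨n, hn⟩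
    obtain ⟨b, -, hb⟩ := Option.map_eq_some_iff.1 hn
    exact ⟨b, (h (a, b)).2 ⟨_, of_decide_eq_true hb⟩⟩
  · rintro ⟨b, hb⟩
    obtain ⟨n, hn⟩ := (h (a, b)).1 hb
    exact ⟨Nat.pair n (Encodable.encode b), by simp [hn]⟩

theorem rePred_forall_mem_list {p : α → β → Prop} {l : α → List β} (hl : Primrec l)
    (hp : REPred fun x : α × β => p x.1 x.2) : REPred fun a => ∀ b ∈ l a, p a b := by
  obtain ⟨R, hR, mR, h⟩ := exists_primrecRel_of_rePred hp
  have h0 : PrimrecRel fun (b : β) (x : α × ℕ) => R (x.1, b) x.2 :=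
    hR.comp (Primrec.pair (Primrec.fst.comp Primrec.snd) Primrec.fst)
      (Primrec.snd.comp Primrec.snd)
  have h1 : PrimrecRel fun (a : α) (n : ℕ) => ∀ b ∈ l a, R (a, b) n :=
    h0.forall_mem_list.comp (hl.comp Primrec.fst) Primrec.id
  refine (rePred_exists_of_primrecRel h1).of_eq fun a => ?_
  constructor
  · rintro ⟨n, hn⟩ b hb
    exact (h (a, b)).2 ⟨n, hn b hb⟩
  · intro H
    generalize l a = L at H
    induction L with
    | nil => exact ⟨0, by simp⟩
    | cons b L ih =>
      obtain ⟨n, hn⟩ := ih fun c hc => H c (List.mem_cons_of_mem _ hc)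
      obtain ⟨m, hm⟩ := (h (a, b)).1 (H b List.mem_cons_self)
      refine ⟨max m n, fun c hc => ?_⟩
      rcases List.mem_cons.1 hc with rfl | hc
      · exact mR _ _ _ (le_max_left _ _) hm
      · exact mR _ _ _ (le_max_right _ _) (hn c hc)

theorem primrecPred_mem_list {f : α → β} {l : α → List β} (hf : Primrec f) (hl : Primrec l) :
    PrimrecPred fun a => f a ∈ l a := by
  have h0 : PrimrecRel fun (b c : β) => b = c := Primrec.eq
  refine (h0.exists_mem_list.comp hl hf).of_eq fun a => ?_
  simp

theorem rePred_exists_mem_list {p : α → β → Prop} {l : α → List β} (hl : Primrec l)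
    (hp : REPred fun x : α × β => p x.1 x.2) : REPred fun a => ∃ b ∈ l a, p a b :=
  rePred_exists (rePred_and (rePred_of_primrecPred
    (primrecPred_mem_list Primrec.snd (hl.comp Primrec.fst))) hp)

end RE

end CompMeas

namespace CompMeas

/-! ### Primitive recursive rational-valued functions -/

section Rat

variable {α β : Type*} [Primcodable α] [Primcodable β]

/-- The rational-valued function `f` is induced by a primitive recursive function on names. -/
def PrimrecRat (f : α → ℚ) : Prop :=
  ∃ g : α → ℕ × ℕ × ℕ, Primrec g ∧ ∀ a, rat (g a) = f a

theorem primrecRat_rat {g : α → ℕ × ℕ × ℕ} (hg : Primrec g) : PrimrecRat fun a => rat (g a) :=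
  ⟨g, hg, fun _ => rfl⟩

theorem primrecRat_natCast {f : α → ℕ} (hf : Primrec f) : PrimrecRat fun a => (f a : ℚ) :=
  ⟨fun a => (f a, 0, 0), hf.pair (Primrec.const _), fun a => by simp [rat]⟩

theorem primrecRat_two : PrimrecRat fun _ : α => (2 : ℚ) :=
  primrecRat_natCast (Primrec.const 2)

theorem primrecRat_natCast_add_one {f : α → ℕ} (hf : Primrec f) :
    PrimrecRat fun a => (f a : ℚ) + 1 := by
  simpa using primrecRat_natCast (Primrec.succ.comp hf)

theorem PrimrecRat.comp {f : β → ℚ} (hf : PrimrecRat f) {h : α → β} (hh : Primrec h) :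
    PrimrecRat fun a => f (h a) := by
  obtain ⟨g, hg, e⟩ := hf
  exact ⟨fun a => g (h a), hg.comp hh, fun a => e _⟩

theorem primrecRat_inv_succ {f : α → ℕ} (hf : Primrec f) :
    PrimrecRat fun a => 1 / ((f a : ℚ) + 1) :=
  ⟨fun a => (1, 0, f a), (Primrec.const 1).pair ((Primrec.const 0).pair hf),
    fun a => by simp [rat]⟩

theorem primrecRat_posRat {f : α → ℕ × ℕ} (hf : Primrec f) :
    PrimrecRat fun a => posRat (f a) :=
  ⟨fun a => ((f a).1 + 1, 0, (f a).2), (Primrec.succ.comp (Primrec.fst.comp hf)).pair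
    ((Primrec.const 0).pair (Primrec.snd.comp hf)), fun a => by simp [rat, posRat]⟩

variable {f g : α → ℚ}

theorem PrimrecRat.neg (hf : PrimrecRat f) : PrimrecRat fun a => -f a := by
  obtain ⟨u, hu, e⟩ := hf
  refine ⟨fun a => ((u a).2.1, (u a).1, (u a).2.2), ?_, fun a => ?_⟩
  · exact (Primrec.fst.comp (Primrec.snd.comp hu)).pair
      ((Primrec.fst.comp hu).pair (Primrec.snd.comp (Primrec.snd.comp hu)))
  · beta_reduce
    rw [← e, rat, rat, ← neg_div, neg_sub]

/-- A name stores its denominator minus one, so this is what a product of two denominators is stored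
as. -/
theorem primrec_mul_succ_sub_one {x y : α → ℕ} (hx : Primrec x) (hy : Primrec y) :
    Primrec fun a => (x a + 1) * (y a + 1) - 1 :=
  Primrec.nat_sub.comp (Primrec.nat_mul.comp (Primrec.succ.comp hx) (Primrec.succ.comp hy))
    (Primrec.const 1)

theorem cast_mul_succ_sub_one (x y : ℕ) :
    ((((x + 1) * (y + 1) - 1 : ℕ) : ℚ) + 1) = (x + 1) * (y + 1) := by
  have : (x + 1) * (y + 1) - 1 + 1 = (x + 1) * (y + 1) :=
    Nat.sub_add_cancel (Nat.mul_pos x.succ_pos y.succ_pos)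
  exact_mod_cast this

theorem PrimrecRat.add (hf : PrimrecRat f) (hg : PrimrecRat g) :
    PrimrecRat fun a => f a + g a := by
  obtain ⟨u, hu, e⟩ := hf
  obtain ⟨v, hv, e'⟩ := hg
  have u1 := Primrec.fst.comp hu
  have u2 := Primrec.fst.comp (Primrec.snd.comp hu)
  have u3 := Primrec.snd.comp (Primrec.snd.comp hu)
  have v1 := Primrec.fst.comp hv
  have v2 := Primrec.fst.comp (Primrec.snd.comp hv)
  have v3 := Primrec.snd.comp (Primrec.snd.comp hv)
  refine ⟨fun a => ((u a).1 * ((v a).2.2 + 1) + (v a).1 * ((u a).2.2 + 1),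
    (u a).2.1 * ((v a).2.2 + 1) + (v a).2.1 * ((u a).2.2 + 1),
    ((u a).2.2 + 1) * ((v a).2.2 + 1) - 1), ?_, fun a => ?_⟩
  · exact (Primrec.nat_add.comp (Primrec.nat_mul.comp u1 (Primrec.succ.comp v3))
      (Primrec.nat_mul.comp v1 (Primrec.succ.comp u3))).pair
      ((Primrec.nat_add.comp (Primrec.nat_mul.comp u2 (Primrec.succ.comp v3))
      (Primrec.nat_mul.comp v2 (Primrec.succ.comp u3))).pair (primrec_mul_succ_sub_one u3 v3))
  · beta_reduce
    rw [← e, ← e', rat, rat, rat, cast_mul_succ_sub_one]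
    push_cast
    field_simp
    ring

theorem PrimrecRat.sub (hf : PrimrecRat f) (hg : PrimrecRat g) :
    PrimrecRat fun a => f a - g a := by
  simpa only [sub_eq_add_neg] using hf.add hg.neg

theorem PrimrecRat.mul (hf : PrimrecRat f) (hg : PrimrecRat g) :
    PrimrecRat fun a => f a * g a := by
  obtain ⟨u, hu, e⟩ := hf
  obtain ⟨v, hv, e'⟩ := hg
  have u1 := Primrec.fst.comp hu
  have u2 := Primrec.fst.comp (Primrec.snd.comp hu)
  have u3 := Primrec.snd.comp (Primrec.snd.comp hu)
  have v1 := Primrec.fst.comp hv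
  have v2 := Primrec.fst.comp (Primrec.snd.comp hv)
  have v3 := Primrec.snd.comp (Primrec.snd.comp hv)
  refine ⟨fun a => ((u a).1 * (v a).1 + (u a).2.1 * (v a).2.1,
    (u a).1 * (v a).2.1 + (u a).2.1 * (v a).1,
    ((u a).2.2 + 1) * ((v a).2.2 + 1) - 1), ?_, fun a => ?_⟩
  · exact (Primrec.nat_add.comp (Primrec.nat_mul.comp u1 v1) (Primrec.nat_mul.comp u2 v2)).pair
      ((Primrec.nat_add.comp (Primrec.nat_mul.comp u1 v2) (Primrec.nat_mul.comp u2 v1)).pair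
        (primrec_mul_succ_sub_one u3 v3))
  · beta_reduce
    rw [← e, ← e', rat, rat, rat, cast_mul_succ_sub_one]
    push_cast
    field_simp
    ring

theorem primrecRat_inv_natCast {f : α → ℕ} (hf : Primrec f) :
    PrimrecRat fun a => ((f a : ℚ))⁻¹ := by
  refine ⟨fun a => if f a = 0 then (0, 0, 0) else (1, 0, f a - 1), ?_, fun a => ?_⟩
  · exact Primrec.ite (Primrec.eq.comp hf (Primrec.const 0)) (Primrec.const _)
      ((Primrec.const 1).pair ((Primrec.const 0).pair (Primrec.nat_sub.comp hf (Primrec.const 1))))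
  · by_cases h : f a = 0
    · simp [h, rat]
    · beta_reduce
      rw [if_neg h, rat, Nat.cast_pred (Nat.pos_of_ne_zero h)]
      simp

theorem PrimrecRat.div_natCast (hf : PrimrecRat f) {g : α → ℕ} (hg : Primrec g) :
    PrimrecRat fun a => f a / g a := by
  simpa only [div_eq_mul_inv] using hf.mul (primrecRat_inv_natCast hg)

theorem PrimrecRat.pow (hf : PrimrecRat f) {n : α → ℕ} (hn : Primrec n) :
    PrimrecRat fun a => f a ^ n a := by
  obtain ⟨u, hu, e⟩ := hf
  have hm : PrimrecRat fun x : (α × (ℕ × ℕ × ℕ)) => rat x.2 * rat (u x.1) :=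
    (primrecRat_rat Primrec.snd).mul (primrecRat_rat (hu.comp Primrec.fst))
  obtain ⟨m, hm, em⟩ := hm
  refine ⟨fun a => (fun z => m (a, z))^[n a] (1, 0, 0), Primrec.nat_iterate hn
    (Primrec.const _) hm, fun a => ?_⟩
  beta_reduce
  rw [← e]
  induction n a with
  | zero => simp [rat]
  | succ k ih => rw [Function.iterate_succ_apply', em, pow_succ, ← ih]

/-- Cross-multiplying and moving the negative parts to the other side leaves a comparison of natural
numbers. -/
theorem PrimrecRat.lt (hf : PrimrecRat f) (hg : PrimrecRat g) :
    PrimrecPred fun a => f a < g a := by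
  obtain ⟨u, hu, e⟩ := hf
  obtain ⟨v, hv, e'⟩ := hg
  have u1 := Primrec.fst.comp hu
  have u2 := Primrec.fst.comp (Primrec.snd.comp hu)
  have u3 := Primrec.snd.comp (Primrec.snd.comp hu)
  have v1 := Primrec.fst.comp hv
  have v2 := Primrec.fst.comp (Primrec.snd.comp hv)
  have v3 := Primrec.snd.comp (Primrec.snd.comp hv)
  refine (Primrec.nat_lt.comp
    (Primrec.nat_add.comp (Primrec.nat_mul.comp u1 (Primrec.succ.comp v3))
      (Primrec.nat_mul.comp v2 (Primrec.succ.comp u3)))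
    (Primrec.nat_add.comp (Primrec.nat_mul.comp v1 (Primrec.succ.comp u3))
      (Primrec.nat_mul.comp u2 (Primrec.succ.comp v3)))).of_eq fun a => ?_
  rw [← e, ← e', rat, rat, div_lt_div_iff₀ (by positivity) (by positivity),
    ← Nat.cast_lt (α := ℚ)]
  push_cast
  constructor <;> intro h <;> nlinarith

theorem exists_rat_eq (q : ℚ) : ∃ n, rat n = q := by
  refine ⟨(q.num.toNat, (-q.num).toNat, q.den - 1), ?_⟩
  have h1 : ((q.num.toNat : ℤ) - ((-q.num).toNat : ℤ)) = q.num := by omega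
  have h2 : ((q.num.toNat : ℚ) - ((-q.num).toNat : ℚ)) = q.num := by exact_mod_cast h1
  rw [rat]
  simp only
  rw [h2, Nat.cast_pred q.den_pos, sub_add_cancel, Rat.num_div_den]

theorem exists_posRat_eq {q : ℚ} (hq : 0 < q) : ∃ n, posRat n = q := by
  refine ⟨(q.num.toNat - 1, q.den - 1), ?_⟩
  have h0 : 0 < q.num := Rat.num_pos.2 hq
  have h1 : ((q.num.toNat - 1 : ℕ) : ℤ) + 1 = q.num := by omega
  have h2 : ((q.num.toNat - 1 : ℕ) : ℚ) + 1 = q.num := by exact_mod_cast h1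
  rw [posRat]
  simp only
  rw [h2, Nat.cast_pred q.den_pos, sub_add_cancel, Rat.num_div_den]

theorem posRat_pos (n : ℕ × ℕ) : 0 < posRat n := by
  unfold posRat
  positivity

end Rat

end CompMeas

namespace CompMeas

open MeasureTheory Set Filter Topology
open scoped ENNReal NNReal

/-! ### Averages along lists of weighted names -/

noncomputable section

/-- The average of `f` over the second components in `l`, where `(w, i)` has weight `w + 1`. -/
def avg (f : ℕ → ℝ) (l : List (ℕ × ℕ)) : ℝ :=
  (l.map fun p => ((p.1 : ℝ) + 1) * f p.2).sum / totalWeight l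

theorem totalWeight_cons (p : ℕ × ℕ) (l : List (ℕ × ℕ)) :
    totalWeight (p :: l) = p.1 + 1 + totalWeight l := by
  simp [totalWeight]

theorem totalWeight_cons_pos (p : ℕ × ℕ) (l : List (ℕ × ℕ)) :
    (0 : ℝ) < totalWeight (p :: l) := by
  rw [totalWeight_cons]
  positivity

theorem avg_mono {f g : ℕ → ℝ} {l : List (ℕ × ℕ)} (h : ∀ p ∈ l, f p.2 ≤ g p.2) :
    avg f l ≤ avg g l := by
  refine div_le_div_of_nonneg_right (List.sum_le_sum fun p hp => ?_) (Nat.cast_nonneg _)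
  exact mul_le_mul_of_nonneg_left (h p hp) (by positivity)

theorem sum_map_weight (l : List (ℕ × ℕ)) :
    (l.map fun p => (p.1 : ℝ) + 1).sum = totalWeight l := by
  induction l with
  | nil => simp [totalWeight]
  | cons p l ih => simp [totalWeight_cons, ih]

theorem avg_add_const (f : ℕ → ℝ) (a : ℝ) (p : ℕ × ℕ) (l : List (ℕ × ℕ)) :
    avg (fun i => f i + a) (p :: l) = avg f (p :: l) + a := by
  have h := (totalWeight_cons_pos p l).ne'
  rw [avg, avg, div_add' _ _ _ h]
  congr 1
  simp only [mul_add]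
  rw [List.sum_map_add, List.sum_map_mul_right, sum_map_weight, mul_comm]

theorem avg_sub_const (f : ℕ → ℝ) (a : ℝ) (p : ℕ × ℕ) (l : List (ℕ × ℕ)) :
    avg (fun i => f i - a) (p :: l) = avg f (p :: l) - a := by
  simpa only [sub_eq_add_neg] using avg_add_const f (-a) p l

/-! ### Integrals against ideal measures. -/

section

variable {X : Type*} [MetricSpace X] [MeasurableSpace X] [BorelSpace X]

/-- The normaliser `W` is independent of the list so that it stays fixed in the induction while the
list shrinks. -/
theorem integrable_diracSum (s : ℕ → X) {W : ℕ} (hW : W ≠ 0) (l : List (ℕ × ℕ)) (f : X → ℝ) :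
    Integrable f (diracSum s W l) ∧
    ∫ x, f x ∂(diracSum s W l) = (l.map fun p => ((p.1 : ℝ) + 1) * f (s p.2)).sum / W := by
  induction l with
  | nil => simp [diracSum]
  | cons p l ih =>
    have h1 : diracSum s W (p :: l) =
        (((p.1 + 1 : ℕ) : ℝ≥0∞) / (W : ℝ≥0∞)) • Measure.dirac (s p.2) + diracSum s W l := by
      simp [diracSum]
    have hfin : ((p.1 + 1 : ℕ) : ℝ≥0∞) / (W : ℝ≥0∞) ≠ ∞ :=
      ENNReal.div_ne_top (ENNReal.natCast_ne_top _) (by exact_mod_cast hW)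
    have h2 : Integrable f ((((p.1 + 1 : ℕ) : ℝ≥0∞) / (W : ℝ≥0∞)) • Measure.dirac (s p.2)) :=
      (integrable_dirac (by simp)).smul_measure hfin
    refine ⟨h1 ▸ h2.add_measure ih.1, ?_⟩
    rw [h1, integral_add_measure h2 ih.1, ih.2, integral_smul_measure, integral_dirac]
    rw [ENNReal.toReal_div, ENNReal.toReal_natCast, ENNReal.toReal_natCast]
    simp only [List.map_cons, List.sum_cons, smul_eq_mul]
    push_cast
    ring

theorem integral_idealMeasure (s : ℕ → X) (n : CombName) (f : X → ℝ) :
    ∫ x, f x ∂(idealMeasure s n).toMeasure = avg (fun i => f (s i)) (n.1 :: n.2) := by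
  have hW : totalWeight (n.1 :: n.2) ≠ 0 := by
    rw [totalWeight_cons]
    omega
  exact (integrable_diracSum s hW _ f).2

theorem idealMeasure_real (s : ℕ → X) (n : CombName) {S : Set X} (hS : MeasurableSet S) :
    (idealMeasure s n).toMeasure.real S =
      avg (fun i => S.indicator (fun _ => (1 : ℝ)) (s i)) (n.1 :: n.2) := by
  rw [← integral_idealMeasure, integral_indicator_const _ hS]
  simp

end

/-! ### Estimates for the distance `W₁`. -/

section

variable {X : Type*} [MetricSpace X] [BoundedSpace X] [MeasurableSpace X] [BorelSpace X]

/-- Replacing `f` by `-f` disposes of the absolute value. -/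
theorem dist_le_of_forall_lipschitz {μ ν : PM X} {c : ℝ}
    (h : ∀ f : X → ℝ, LipschitzWith 1 f →
      ∫ x, f x ∂μ.toMeasure - ∫ x, f x ∂ν.toMeasure ≤ c) : dist μ ν ≤ c := by
  refine ciSup_le fun f => abs_le.2 ⟨?_, h f.1 f.2⟩
  have := h (fun x => -f.1 x) (LipschitzWith.of_dist_le_mul fun x y => by
    rw [dist_neg_neg]
    exact f.2.dist_le_mul x y)
  rw [integral_neg, integral_neg] at this
  linarith

theorem integral_sub_le_dist (μ ν : PM X) {f : X → ℝ} (hf : LipschitzWith 1 f) :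
    ∫ x, f x ∂μ.toMeasure - ∫ x, f x ∂ν.toMeasure ≤ dist μ ν :=
  (le_abs_self _).trans (le_W1 μ ν hf)

/-- Test against a 1-Lipschitz cutoff lying between `δ` times the indicators of the two balls, then
divide by `δ`. -/
theorem real_ball_le (μ ν : PM X) (x : X) (r : ℝ) {δ : ℝ} (hδ : 0 < δ) :
    ν.toMeasure.real (Metric.ball x r) ≤
      μ.toMeasure.real (Metric.ball x (r + δ)) + dist ν μ / δ := by
  set f : X → ℝ := fun y => max 0 (min δ (r + δ - dist y x)) with hfdef
  have hf : LipschitzWith 1 f := by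
    have h1 : LipschitzWith 1 fun y : X => r + δ - dist y x := by
      refine LipschitzWith.of_dist_le_mul fun y z => ?_
      rw [Real.dist_eq, NNReal.coe_one, one_mul]
      have := abs_dist_sub_le y z x
      rw [← abs_neg]
      convert this using 2
      ring
    exact (h1.const_min δ).const_max 0
  have hi := integrable_of_lipschitz hf
  have h1 : δ * ν.toMeasure.real (Metric.ball x r) ≤ ∫ y, f y ∂ν.toMeasure := by
    have : ∫ y, (Metric.ball x r).indicator (fun _ => δ) y ∂ν.toMeasure
        ≤ ∫ y, f y ∂ν.toMeasure := by
      refine integral_mono ((integrable_const δ).indicator Metric.isOpen_ball.measurableSet)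
        (hi ν) fun y => ?_
      by_cases hy : y ∈ Metric.ball x r
      · rw [indicator_of_mem hy]
        have : dist y x < r := hy
        exact (le_min le_rfl (by linarith)).trans (le_max_right _ _)
      · rw [indicator_of_notMem hy]
        exact le_max_left _ _
    rw [integral_indicator_const _ Metric.isOpen_ball.measurableSet, smul_eq_mul] at this
    linarith
  have h2 : ∫ y, f y ∂μ.toMeasure ≤ δ * μ.toMeasure.real (Metric.ball x (r + δ)) := by
    have : ∫ y, f y ∂μ.toMeasure ≤
        ∫ y, (Metric.ball x (r + δ)).indicator (fun _ => δ) y ∂μ.toMeasure := by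
      refine integral_mono (hi μ)
        ((integrable_const δ).indicator Metric.isOpen_ball.measurableSet) fun y => ?_
      by_cases hy : y ∈ Metric.ball x (r + δ)
      · rw [indicator_of_mem hy]
        exact max_le hδ.le (min_le_left _ _)
      · rw [indicator_of_notMem hy]
        have : r + δ ≤ dist y x := not_lt.1 hy
        exact max_le le_rfl ((min_le_right _ _).trans (by linarith))
    rw [integral_indicator_const _ Metric.isOpen_ball.measurableSet, smul_eq_mul] at this
    linarith
  have h3 := integral_sub_le_dist ν μ hf
  rw [← sub_le_iff_le_add', le_div_iff₀ hδ]
  nlinarith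

end

/-! ### Tuples over a list -/

/-- The list of all lists of length `n` with entries in `l`. -/
def tuples (l : List ℕ) (n : ℕ) : List (List ℕ) :=
  (fun T => T.flatMap fun t => l.map fun i => i :: t)^[n] [[]]

theorem mem_tuples {l : List ℕ} {n : ℕ} {t : List ℕ} :
    t ∈ tuples l n ↔ t.length = n ∧ ∀ i ∈ t, i ∈ l := by
  induction n generalizing t with
  | zero =>
    simp only [tuples, Function.iterate_zero, id, List.mem_singleton, List.length_eq_zero_iff]
    constructor
    · rintro rfl
      simp
    · exact fun h => h.1
  | succ n ih =>
    have h : tuples l (n + 1) = (tuples l n).flatMap fun t => l.map fun i => i :: t := by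
      rw [tuples, Function.iterate_succ_apply']
      rfl
    rw [h]
    simp only [List.mem_flatMap, List.mem_map, ih]
    constructor
    · rintro ⟨t, ⟨rfl, ht⟩, i, hi, rfl⟩
      simpa [hi] using ht
    · rintro ⟨h1, h2⟩
      cases t with
      | nil => simp at h1
      | cons i t =>
        exact ⟨t, ⟨by simpa using h1, fun j hj => h2 j (List.mem_cons_of_mem _ hj)⟩, i,
          h2 i List.mem_cons_self, rfl⟩

/-! ### Finite nets of empirical measures -/

/-- The first index `i` in the list `l` with `dist x (s i) < ε`. -/
def firstNear {X : Type*} [MetricSpace X] (s : ℕ → X) (ε : ℝ) : List ℕ → X → ℕ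
  | [], _ => 0
  | i :: l, x => open Classical in if x ∈ Metric.ball (s i) ε then i else firstNear s ε l x

section

variable {X : Type*} [MetricSpace X]

theorem firstNear_spec (s : ℕ → X) (ε : ℝ) {l : List ℕ} {x : X}
    (h : ∃ i ∈ l, x ∈ Metric.ball (s i) ε) :
    firstNear s ε l x ∈ l ∧ x ∈ Metric.ball (s (firstNear s ε l x)) ε := by
  induction l with
  | nil => simp at h
  | cons i l ih =>
    by_cases hx : x ∈ Metric.ball (s i) ε
    · rw [firstNear, if_pos hx]
      exact ⟨List.mem_cons_self, hx⟩
    · rw [firstNear, if_neg hx]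
      obtain ⟨j, hj, hj'⟩ := h
      rcases List.mem_cons.1 hj with rfl | hj
      · exact absurd hj' hx
      · exact ⟨List.mem_cons_of_mem _ (ih ⟨j, hj, hj'⟩).1, (ih ⟨j, hj, hj'⟩).2⟩

theorem measurable_firstNear [MeasurableSpace X] [BorelSpace X] (s : ℕ → X) (ε : ℝ)
    (l : List ℕ) : Measurable (firstNear s ε l) := by
  induction l with
  | nil => exact measurable_const
  | cons i l ih => exact Measurable.ite Metric.isOpen_ball.measurableSet measurable_const ih

/-- The name of the uniform measure on the ideal points listed in `i :: t`. -/
def uniformName (i : ℕ) (t : List ℕ) : CombName := ((0, i), t.map fun j => (0, j))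

theorem avg_uniformName (f : ℕ → ℝ) (i : ℕ) (t : List ℕ) :
    avg f ((uniformName i t).1 :: (uniformName i t).2) =
      ((i :: t).map f).sum / (t.length + 1) := by
  have h : totalWeight ((uniformName i t).1 :: (uniformName i t).2) = t.length + 1 := by
    simp [totalWeight, uniformName, Function.comp_def, add_comm]
  rw [avg, h]
  simp [uniformName, Function.comp_def]

/-- Moving each point to a net point costs at most `ε`. Rounding the resulting weights down to
multiples of `1 / (N + 1)` and giving the lost mass to one net point moves at most `1 / (N + 1)` per
net point over a distance at most `D`; by `hN` this costs at most `ε` more. -/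
theorem exists_uniformName_dist_le [BoundedSpace X] [MeasurableSpace X] [BorelSpace X]
    (s : ℕ → X) {D : ℝ} (hD : Metric.diam (univ : Set X) ≤ D) {ε : ℝ} {l : List ℕ}
    (hl : ∀ x, ∃ i ∈ l, x ∈ Metric.ball (s i) ε) {N : ℕ} (hN : D * l.length ≤ (N + 1) * ε)
    (μ : PM X) :
    ∃ i ∈ l, ∃ t ∈ tuples l N, dist μ (idealMeasure s (uniformName i t)) ≤ 2 * ε := by
  obtain ⟨x₀⟩ : Nonempty X := nonempty_of_isProbabilityMeasure μ.toMeasure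
  obtain ⟨i₀, hi₀, -⟩ := hl x₀
  set T := firstNear s ε l with hT
  have hTm : Measurable T := measurable_firstNear s ε l
  have hTs := fun x => firstNear_spec s ε (hl x)
  set I := l.toFinset
  set p : ℕ → ℝ := fun i => μ.toMeasure.real (T ⁻¹' {i}) with hp
  have hint : ∀ g : ℕ → ℝ, ∫ x, g (T x) ∂μ.toMeasure = ∑ i ∈ I, p i * g i := by
    intro g
    have h1 : ∀ x, g (T x) = ∑ i ∈ I, (T ⁻¹' {i}).indicator (fun _ : X => g i) x := by
      intro x
      rw [Finset.sum_eq_single (T x)]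
      · simp
      · intro j _ hj
        rw [indicator_of_notMem]
        exact fun h => hj (mem_singleton_iff.1 h).symm
      · intro h
        exact absurd (List.mem_toFinset.2 (hTs x).1) h
    simp only [h1]
    rw [integral_finsetSum]
    · refine Finset.sum_congr rfl fun i _ => ?_
      rw [integral_indicator_const _ (hTm (measurableSet_singleton i)), smul_eq_mul]
    · exact fun i _ => (integrable_const _).indicator (hTm (measurableSet_singleton i))
  have hp1 : ∑ i ∈ I, p i = 1 := by
    have := hint fun _ => 1
    simpa using this.symm
  set a : ℕ → ℕ := fun i => ⌊((N : ℝ) + 1) * p i⌋₊ with ha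
  have ha1 : ∀ i, (a i : ℝ) ≤ (N + 1) * p i := fun i =>
    Nat.floor_le (mul_nonneg (by positivity) measureReal_nonneg)
  have ha2 : ∀ i, (N + 1) * p i ≤ a i + 1 := fun i => (Nat.lt_floor_add_one _).le
  have hsum : ∑ i ∈ I, a i ≤ N + 1 := by
    have : ((∑ i ∈ I, a i : ℕ) : ℝ) ≤ (N + 1 : ℕ) := by
      push_cast
      calc ∑ i ∈ I, (a i : ℝ) ≤ ∑ i ∈ I, ((N : ℝ) + 1) * p i := Finset.sum_le_sum fun i _ => ha1 i
        _ = N + 1 := by rw [← Finset.mul_sum, hp1, mul_one]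
    exact_mod_cast this
  obtain ⟨b, hb⟩ := Nat.exists_eq_add_of_le hsum
  -- Each `i` is repeated `a i` times; the `b` copies of `i₀` absorb the rounding loss and bring the
  -- length to exactly `N + 1`.
  set u := (I.toList.flatMap fun i => List.replicate (a i) i) ++ List.replicate b i₀ with hu
  have husum : ∀ f : ℕ → ℝ, (u.map f).sum = ∑ i ∈ I, (a i : ℝ) * f i + b * f i₀ := by
    intro f
    rw [hu, List.map_append, List.sum_append, List.map_flatMap, List.flatMap_def, List.sum_flatten,
      List.map_map]
    simp [Function.comp_def, Finset.sum_map_toList]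
  have hulen : u.length = N + 1 := by
    have := husum fun _ => 1
    have h2 : (u.length : ℝ) = (N + 1 : ℕ) := by
      rw [hb]
      simpa using this
    exact_mod_cast h2
  have humem : ∀ i ∈ u, i ∈ l := by
    intro i hi
    rcases List.mem_append.1 hi with hi | hi
    · obtain ⟨j, hj, hi⟩ := List.mem_flatMap.1 hi
      rw [List.eq_of_mem_replicate hi]
      simpa [I] using hj
    · rwa [List.eq_of_mem_replicate hi]
  obtain ⟨i, t, hit⟩ : ∃ i t, u = i :: t := List.exists_cons_of_length_eq_add_one hulen
  rw [hit] at humem husum hulen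
  have htlen : t.length = N := by simpa using hulen
  refine ⟨i, humem i List.mem_cons_self, t,
    mem_tuples.2 ⟨htlen, fun j hj => humem j (List.mem_cons_of_mem _ hj)⟩, ?_⟩
  refine dist_le_of_forall_lipschitz fun f hf => ?_
  rw [integral_idealMeasure, avg_uniformName, husum, htlen]
  have h1 : ∫ x, f x ∂μ.toMeasure ≤ ∑ i ∈ I, p i * f (s i) + ε := by
    rw [← hint fun i => f (s i)]
    have h2 : ∀ x, |f (s (T x)) - f x| ≤ ε := fun x => by
      have h3 := hf.dist_le_mul (s (T x)) x
      have h4 : dist x (s (T x)) < ε := (hTs x).2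
      rw [Real.dist_eq, NNReal.coe_one, one_mul, dist_comm] at h3
      linarith
    have h5 : Integrable (fun x => f (s (T x))) μ.toMeasure := by
      refine Integrable.of_bound (C := |f x₀| + D)
        ((measurable_from_nat (f := fun i => f (s i))).comp hTm).aestronglyMeasurable
        (Filter.Eventually.of_forall fun x => ?_)
      have h := abs_sub_le_diam hf (s (T x)) x₀
      rw [Real.norm_eq_abs]
      have := abs_sub_abs_le_abs_sub (f (s (T x))) (f x₀)
      linarith
    calc ∫ x, f x ∂μ.toMeasure ≤ ∫ x, (f (s (T x)) + ε) ∂μ.toMeasure := by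
          refine integral_mono (integrable_of_lipschitz hf μ) (h5.add (integrable_const _))
            fun x => ?_
          have := (abs_le.1 (h2 x)).1
          simp only
          linarith
      _ = _ := by
          rw [integral_add h5 (integrable_const _)]
          simp
  -- The rounding loss at `i`, between 0 and 1 in units of `1 / (N + 1)`, travels from `s i` to `s
  -- i₀`.
  have h6 : ∑ i ∈ I, ((N + 1) * p i - a i) * (f (s i) - f (s i₀)) ≤ (N + 1) * ε := by
    have hcard : (I.card : ℝ) ≤ l.length := by exact_mod_cast l.toFinset_card_le
    have hD0 : 0 ≤ D := Metric.diam_nonneg.trans hD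
    calc _ ≤ ∑ i ∈ I, D := Finset.sum_le_sum fun i _ => by
          have h7 := (le_abs_self _).trans ((abs_sub_le_diam hf (s i) (s i₀)).trans hD)
          have h8 := ha1 i
          have h9 := ha2 i
          nlinarith
      _ = I.card * D := by simp
      _ ≤ D * l.length := by nlinarith
      _ ≤ _ := hN
  have h7 : ∑ i ∈ I, ((N + 1) * p i - a i) * (f (s i) - f (s i₀)) =
      (N + 1) * ∑ i ∈ I, p i * f (s i) - (∑ i ∈ I, a i * f (s i) + b * f (s i₀)) := by
    have hb' : ((N : ℝ) + 1) = ∑ i ∈ I, (a i : ℝ) + b := by exact_mod_cast hb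
    have : ∀ i, ((N + 1) * p i - a i) * (f (s i) - f (s i₀)) =
        (N + 1) * (p i * f (s i)) - a i * f (s i) - (N + 1) * f (s i₀) * p i
          + a i * f (s i₀) := fun i => by ring
    simp only [this, Finset.sum_add_distrib, Finset.sum_sub_distrib, ← Finset.mul_sum, hp1,
      ← Finset.sum_mul]
    rw [show ∑ i ∈ I, (a i : ℝ) = N + 1 - b by linarith]
    ring
  have hNpos : (0 : ℝ) < N + 1 := by positivity
  have h8 : ∑ i ∈ I, p i * f (s i) - ε ≤
      (∑ i ∈ I, a i * f (s i) + b * f (s i₀)) / (N + 1) := by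
    rw [le_div_iff₀ hNpos]
    nlinarith
  linarith

/-! ### Compactness of `PM X`. -/

theorem exists_list_cover (s : ℕ → X) (hs : DenseRange s) (hX : IsCompact (univ : Set X))
    {ε : ℝ} (hε : 0 < ε) : ∃ l : List ℕ, ∀ x, ∃ i ∈ l, x ∈ Metric.ball (s i) ε := by
  obtain ⟨t, ht⟩ := hX.elim_finite_subcover (fun i : ℕ => Metric.ball (s i) ε)
    (fun i => Metric.isOpen_ball) fun x _ => by
      obtain ⟨i, hi⟩ := hs.exists_dist_lt x hε
      exact mem_iUnion.2 ⟨i, hi⟩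
  refine ⟨t.toList, fun x => ?_⟩
  simpa using ht (mem_univ x)

theorem compactSpace_PM [BoundedSpace X] [MeasurableSpace X] [BorelSpace X]
    (s : ℕ → X) (hs : DenseRange s) (hX : IsCompact (univ : Set X)) : CompactSpace (PM X) := by
  have : CompactSpace X := ⟨hX⟩
  refine ⟨isCompact_iff_totallyBounded_isComplete.2 ⟨?_, ?_⟩⟩
  · refine Metric.totallyBounded_iff.2 fun ε hε => ?_
    obtain ⟨l, hl⟩ := exists_list_cover s hs hX (ε := ε / 3) (by positivity)
    obtain ⟨N, hN⟩ := exists_nat_gt (Metric.diam (univ : Set X) * l.length / (ε / 3))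
    rw [div_lt_iff₀ (by positivity)] at hN
    refine ⟨(fun x : ℕ × List ℕ => idealMeasure s (uniformName x.1 x.2)) ''
      ({i | i ∈ l} ×ˢ {t | t ∈ tuples l N}),
      ((List.finite_toSet l).prod (List.finite_toSet _)).image _, fun μ _ => ?_⟩
    obtain ⟨i, hi, t, ht, h⟩ := exists_uniformName_dist_le s le_rfl hl (N := N)
      (by nlinarith) μ
    refine mem_iUnion₂.2 ⟨_, mem_image_of_mem _ (x := (i, t)) ⟨hi, ht⟩, ?_⟩
    exact lt_of_le_of_lt h (by linarith)
  · refine completeSpace_iff_isComplete_univ.1 (Metric.complete_of_cauchySeq_tendsto fun u hu => ?_)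
    let v : ℕ → ProbabilityMeasure X := fun n => ⟨(u n).toMeasure, (u n).isProb⟩
    -- The candidate limit is a weak limit along an ultrafilter, available since probability
    -- measures on compact `X` are weakly compact.
    let U : Ultrafilter (ProbabilityMeasure X) := (hyperfilter ℕ).map v
    have hU : Tendsto v (hyperfilter ℕ) (𝓝 U.lim) := U.le_nhds_lim
    refine ⟨⟨U.lim, U.lim.2⟩, Metric.tendsto_atTop.2 fun ε hε => ?_⟩
    obtain ⟨N, hN⟩ := Metric.cauchySeq_iff.1 hu (ε / 2) (by positivity)
    refine ⟨N, fun n hn => lt_of_le_of_lt (dist_le_of_forall_lipschitz (c := ε / 2)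
      fun f hf => ?_) (by linarith)⟩
    have h1 := (ProbabilityMeasure.tendsto_iff_forall_integral_tendsto.1 hU)
      (BoundedContinuousFunction.mkOfCompact ⟨f, hf.continuous⟩)
    -- Weak convergence is used for one `f` at a time; uniformity in `f` comes from the Cauchy
    -- bound.
    refine le_of_tendsto (h1.const_sub _) ?_
    have h2 : ∀ᶠ m in (hyperfilter ℕ : Filter ℕ), N ≤ m :=
      (Nat.hyperfilter_le_atTop) (eventually_ge_atTop N)
    filter_upwards [h2] with m hm
    exact (integral_sub_le_dist (u n) (u m) hf).trans (hN n hn m hm).le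

end

end

end CompMeas

namespace CompMeas

open MeasureTheory Set Filter Topology
open scoped ENNReal NNReal

/-! ### The sets `V` -/

section

variable {X : Type*} [MetricSpace X] [MeasurableSpace X]

theorem mem_V_iff {α K : ℝ} (hK : 0 ≤ K) {μ : PM X} :
    μ ∈ V X α K ↔ ∀ x : X, ∀ r : ℝ, 0 < r → μ.toMeasure.real (Metric.ball x r) ≤ K * r ^ α := by
  have h1 : (K : EReal) = ((ENNReal.ofReal K : ℝ≥0∞) : EReal) := by
    rw [EReal.coe_ennreal_ofReal, max_eq_left hK]
  rw [V, mem_ofPred_eq, h1, EReal.coe_ennreal_le_coe_ennreal_iff, alphaNorm]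
  simp only [iSup_le_iff]
  refine forall_congr' fun x => forall_congr' fun r => forall_congr' fun hr => ?_
  have hr' : 0 < r ^ α := Real.rpow_pos_of_pos hr α
  rw [ENNReal.div_le_iff (by simpa using hr') ENNReal.ofReal_ne_top, ← ENNReal.ofReal_mul hK,
    ENNReal.le_ofReal_iff_toReal_le (measure_ne_top _ _) (by positivity)]
  rfl

theorem V_eq_empty {α K : ℝ} (hK : K < 0) : V X α K = ∅ := by
  refine eq_empty_of_forall_notMem fun μ hμ => ?_
  have h1 : (0 : EReal) ≤ (alphaNorm α μ : EReal) := EReal.coe_ennreal_nonneg _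
  have h2 : (0 : EReal) ≤ (K : EReal) := h1.trans hμ
  exact absurd (EReal.coe_nonneg.1 h2) (not_le.2 hK)

/-- Continuity from below, an open ball being the increasing union of concentric smaller ones. -/
theorem exists_lt_real_ball (μ : PM X) (x : X) (r : ℝ) {c : ℝ}
    (hc : c < μ.toMeasure.real (Metric.ball x r)) :
    ∃ r' < r, c < μ.toMeasure.real (Metric.ball x r') := by
  have hU : Metric.ball x r = ⋃ n : ℕ, Metric.ball x (r - 1 / ((n : ℝ) + 1)) := by
    ext y
    simp only [Metric.mem_ball, mem_iUnion]
    constructor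
    · intro hy
      obtain ⟨n, hn⟩ := exists_nat_one_div_lt (sub_pos.2 hy)
      exact ⟨n, by linarith⟩
    · rintro ⟨n, hn⟩
      have : (0 : ℝ) < 1 / ((n : ℝ) + 1) := by positivity
      linarith
  have hmono : Monotone fun n : ℕ => Metric.ball x (r - 1 / ((n : ℝ) + 1)) := fun m n hmn =>
    Metric.ball_subset_ball (by
      have := Nat.one_div_le_one_div (α := ℝ) hmn
      linarith)
  have ht := tendsto_measure_iUnion_atTop (μ := μ.toMeasure) hmono
  rw [← hU] at ht
  have ht' := (ENNReal.tendsto_toReal (measure_ne_top μ.toMeasure (Metric.ball x r))).comp ht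
  obtain ⟨n, hn⟩ := (ht'.eventually (lt_mem_nhds hc)).exists
  exact ⟨_, sub_lt_self _ (by positivity), hn⟩

/-- The violation is strict, so there is room to make centre and radius ideal. One margin `1 / (m +
1)` will be spent in passing from `μ` to a nearby ideal measure, the other in passing from that to
all measures near it. -/
theorem exists_ideal_ball_of_notMem_V {s : ℕ → X} (hs : DenseRange s) {α K : ℝ} (hK : 0 ≤ K)
    {μ : PM X} (hμ : μ ∉ V X α K) :
    ∃ (i : ℕ) (r : ℕ × ℕ) (m : ℕ), K * (posRat r : ℝ) ^ α <
      μ.toMeasure.real (Metric.ball (s i) (posRat r - 2 * (1 / ((m : ℝ) + 1)))) := by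
  rw [mem_V_iff hK] at hμ
  push Not at hμ
  obtain ⟨x, r, hr, h⟩ := hμ
  obtain ⟨c, hc1, hc2⟩ := exists_between h
  obtain ⟨r₁, hr₁, h₁⟩ := exists_lt_real_ball μ x r hc2
  have hcont : ContinuousAt (fun y : ℝ => K * y ^ α) r :=
    (Real.continuousAt_rpow_const r α (Or.inl hr.ne')).const_mul K
  obtain ⟨η, hη, hball⟩ := Metric.eventually_nhds_iff.1 (hcont.eventually (gt_mem_nhds hc1))
  -- `q > r₁` leaves room inside the ball, `q > 0` makes it a legal radius, and `q > r - η` keeps `K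
  -- * q ^ α` below `c`.
  obtain ⟨q, hq1, hq2⟩ := exists_rat_btwn (show max (max r₁ 0) (r - η) < r from
    max_lt (max_lt hr₁ hr) (by linarith))
  obtain ⟨⟨hq3, hq4⟩, hq5⟩ : (r₁ < q ∧ (0 : ℝ) < q) ∧ r - η < q := by
    simpa only [max_lt_iff] using hq1
  obtain ⟨n, hn⟩ := exists_posRat_eq (q := q) (by exact_mod_cast hq4)
  -- Of the gap `q - r₁`, two thirds pay for the two margins and one third for the shift of the
  -- centre.
  obtain ⟨m, hm⟩ := exists_nat_one_div_lt (show 0 < (q - r₁) / 3 by linarith)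
  obtain ⟨i, hi⟩ := hs.exists_dist_lt x (show 0 < (q - r₁) / 3 by linarith)
  refine ⟨i, n, m, ?_⟩
  rw [hn]
  calc K * (q : ℝ) ^ α < c := hball (by
        rw [Real.dist_eq, abs_lt]
        constructor <;> linarith)
    _ < _ := h₁
    _ ≤ _ := measureReal_mono (Metric.ball_subset_ball' (by linarith)) (measure_ne_top _ _)

variable [BoundedSpace X] [BorelSpace X]

theorem isClosed_V {α K : ℝ} (hK : 0 ≤ K) : IsClosed (V X α K) := by
  refine isOpen_compl_iff.1 (Metric.isOpen_iff.2 fun μ hμ => ?_)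
  rw [mem_compl_iff, mem_V_iff hK] at hμ
  push Not at hμ
  obtain ⟨x, r, hr, h⟩ := hμ
  obtain ⟨r', hr', h'⟩ := exists_lt_real_ball μ x r h
  set δ := r - r' with hδ
  have hδ0 : 0 < δ := sub_pos.2 hr'
  set τ := μ.toMeasure.real (Metric.ball x r') - K * r ^ α with hτ
  have hτ0 : 0 < τ := sub_pos.2 h'
  -- `real_ball_le` with enlargement `δ` loses `dist / δ`, which must stay below `τ`.
  refine ⟨δ * τ, by positivity, fun ν hν => ?_⟩
  rw [mem_compl_iff, mem_V_iff hK]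
  push Not
  refine ⟨x, r, hr, ?_⟩
  have h1 := real_ball_le ν μ x r' hδ0
  rw [show r' + δ = r by rw [hδ]; ring] at h1
  have h2 : dist μ ν / δ < τ := by
    rw [div_lt_iff₀ hδ0, dist_comm]
    rw [Metric.mem_ball] at hν
    linarith
  linarith

end

/-! ### Rational bounds for powers -/

/-- Raising to the power of the denominator leaves integer exponents, hence a decidable comparison
of rationals. -/
theorem rpow_rat_lt_iff {r u : ℚ} (hr : 0 < r) (hu : 0 < u) (q : ℕ × ℕ × ℕ) :
    (r : ℝ) ^ (rat q : ℝ) < u ↔ r ^ q.1 < u ^ (q.2.2 + 1) * r ^ q.2.1 := by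
  have hr' : (0 : ℝ) < r := by exact_mod_cast hr
  have hu' : (0 : ℝ) < u := by exact_mod_cast hu
  rw [← pow_lt_pow_iff_left₀ (Real.rpow_nonneg hr'.le _) hu'.le (Nat.succ_ne_zero q.2.2),
    ← Real.rpow_mul_natCast hr'.le]
  have h : (rat q : ℝ) * (q.2.2.succ : ℝ) = (q.1 : ℝ) - (q.2.1 : ℝ) := by
    rw [rat]
    push_cast
    field_simp
  rw [h, Real.rpow_sub hr', Real.rpow_natCast, Real.rpow_natCast, div_lt_iff₀ (by positivity)]
  exact_mod_cast Iff.rfl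

/-- The map `y ↦ r ^ y` is monotone, increasing or decreasing according to whether `r` exceeds 1.
Bounding it at both ends of an interval around `α` covers either case; continuity supplies such an
interval. -/
theorem mul_rpow_lt_iff {α K : ℝ} (hK : 0 ≤ K) {r v : ℝ} (hr : 0 < r) :
    K * r ^ α < v ↔ ∃ (k : ℕ × ℕ × ℕ) (u : ℕ × ℕ) (q q' : ℕ × ℕ × ℕ),
      K < rat k ∧ rat q < α ∧ α < rat q' ∧ r ^ (rat q : ℝ) < posRat u ∧
        r ^ (rat q' : ℝ) < posRat u ∧ (rat k : ℝ) * posRat u < v := by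
  constructor
  · intro h
    have hrp : 0 < r ^ α := Real.rpow_pos_of_pos hr α
    obtain ⟨k, hk1, hk2⟩ := exists_rat_btwn ((lt_div_iff₀ hrp).2 h)
    rw [lt_div_iff₀ hrp] at hk2
    have hk0 : (0 : ℝ) < k := hK.trans_lt hk1
    obtain ⟨u, hu1, hu2⟩ := exists_rat_btwn ((lt_div_iff₀' hk0).2 hk2)
    rw [lt_div_iff₀' hk0] at hu2
    have hu0 : (0 : ℚ) < u := by exact_mod_cast hrp.trans hu1
    have hcont : ContinuousAt (fun y : ℝ => r ^ y) α := Real.continuousAt_const_rpow hr.ne'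
    obtain ⟨η, hη, hball⟩ := Metric.eventually_nhds_iff.1 (hcont.eventually (gt_mem_nhds hu1))
    obtain ⟨q, hq1, hq2⟩ := exists_rat_btwn (show α - η < α by linarith)
    obtain ⟨q', hq1', hq2'⟩ := exists_rat_btwn (show α < α + η by linarith)
    obtain ⟨k, rfl⟩ := exists_rat_eq k
    obtain ⟨q, rfl⟩ := exists_rat_eq q
    obtain ⟨q', rfl⟩ := exists_rat_eq q'
    obtain ⟨u, rfl⟩ := exists_posRat_eq hu0
    refine ⟨k, u, q, q', hk1, hq2, hq1', hball ?_, hball ?_, hu2⟩ <;>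
    · rw [Real.dist_eq, abs_lt]
      constructor <;> linarith
  · rintro ⟨k, u, q, q', hk, hq, hq', h1, h2, h3⟩
    have h4 : r ^ α ≤ posRat u := by
      rcases le_total 1 r with h | h
      · exact (Real.rpow_le_rpow_of_exponent_le h hq'.le).trans h2.le
      · exact (Real.rpow_le_rpow_of_exponent_ge hr h hq.le).trans h1.le
    have hu0 : (0 : ℝ) < posRat u := by exact_mod_cast posRat_pos u
    calc K * r ^ α ≤ K * posRat u := mul_le_mul_of_nonneg_left h4 hK
      _ ≤ rat k * posRat u := mul_le_mul_of_nonneg_right hk.le hu0.le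
      _ < v := h3

/-! ### The Wasserstein distance of ideal measures -/

/-- The total of the values `g.getD i 0` along the list `l`, where `(w, i)` has weight `w + 1`. -/
def gridSum (g : List ℕ) (l : List (ℕ × ℕ)) : ℕ :=
  (l.map fun p => (p.1 + 1) * g.getD p.2 0).sum

theorem avg_grid (η : ℝ) (g : List ℕ) (l : List (ℕ × ℕ)) :
    avg (fun i => η * (g.getD i 0 : ℕ)) l = η * (gridSum g l / totalWeight l) := by
  rw [avg, gridSum, ← mul_div_assoc]
  congr 1
  induction l with
  | nil => simp
  | cons p l ih =>
    simp only [List.map_cons, List.sum_cons, ih]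
    push_cast
    ring

/-- A function with values in the multiples of `η = 1 / (e + 1)`, given by a list `g`, violates
the Lipschitz condition up to `η` or has a small difference of averages. -/
def GridCondition {X : Type*} [MetricSpace X] (s : ℕ → X) (A B : CombName) (c : ℚ) (e H : ℕ)
    (g : List ℕ) : Prop :=
  (∃ a ∈ List.range H, ∃ b ∈ List.range H, dist (s a) (s b) <
    ((1 / ((e : ℚ) + 1) * ((g.getD a 0 : ℕ) - (g.getD b 0 : ℕ)) - 1 / ((e : ℚ) + 1) : ℚ) : ℝ)) ∨
  1 / ((e : ℚ) + 1) * (gridSum g (A.1 :: A.2) / totalWeight (A.1 :: A.2)) -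
    1 / ((e : ℚ) + 1) * (gridSum g (B.1 :: B.2) / totalWeight (B.1 :: B.2)) <
      c - 2 * (1 / ((e : ℚ) + 1))

section

variable {X : Type*} [MetricSpace X]

/-- McShane's extension formula, which tolerates a Lipschitz defect `η`. -/
theorem exists_lipschitz_near (s : ℕ → X) {H : ℕ} (hH : 0 < H) (f : ℕ → ℝ) {η : ℝ}
    (hf : ∀ a < H, ∀ b < H, f a - f b ≤ dist (s a) (s b) + η) :
    ∃ F : X → ℝ, LipschitzWith 1 F ∧ ∀ a < H, F (s a) ≤ f a ∧ f a ≤ F (s a) + η := by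
  have hne : (Finset.range H).Nonempty := ⟨0, Finset.mem_range.2 hH⟩
  refine ⟨fun x => (Finset.range H).inf' hne fun b => f b + dist x (s b), ?_, fun a ha => ⟨?_, ?_⟩⟩
  · refine LipschitzWith.of_le_add fun x y => ?_
    obtain ⟨b, hb, h⟩ := Finset.exists_mem_eq_inf' hne fun b => f b + dist y (s b)
    rw [h]
    refine (Finset.inf'_le _ hb).trans ?_
    have := dist_triangle x y (s b)
    linarith
  · refine (Finset.inf'_le _ (Finset.mem_range.2 ha)).trans ?_
    simp
  · rw [← sub_le_iff_le_add]
    refine Finset.le_inf' hne _ fun b hb => ?_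
    have := hf a ha b (Finset.mem_range.1 hb)
    linarith

/-- Only values at the finitely many points below `H` matter, and up to a constant a 1-Lipschitz
function has values in `[0, D]`. Rounding them to multiples of `η = 1 / (e + 1)` leaves finitely
many functions; conversely, McShane's extension turns an almost Lipschitz grid function into a
genuine one. -/
theorem dist_idealMeasure_lt_iff [BoundedSpace X] [MeasurableSpace X] [BorelSpace X] (s : ℕ → X)
    {D : ℕ} (hD : Metric.diam (univ : Set X) ≤ D) (A B : CombName) (c : ℚ) :
    dist (idealMeasure s A) (idealMeasure s B) < c ↔
      ∃ e H M : ℕ, (∀ p ∈ A.1 :: A.2, p.2 < H) ∧ (∀ p ∈ B.1 :: B.2, p.2 < H) ∧ D * (e + 1) < M ∧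
        ∀ g ∈ tuples (List.range M) H, GridCondition s A B c e H g := by
  constructor
  · intro h
    -- The extension costs `η` and `GridCondition` demands a margin `2 * η`, so a gap of `4 * η` is
    -- ample.
    obtain ⟨e, he⟩ := exists_nat_one_div_lt
      (show 0 < (c - dist (idealMeasure s A) (idealMeasure s B)) / 4 by linarith)
    set H := ((A.1 :: A.2).map Prod.snd).sum + ((B.1 :: B.2).map Prod.snd).sum + 1 with hH
    have hA : ∀ p ∈ A.1 :: A.2, p.2 < H := fun p hp => by
      have := List.single_le_sum (l := (A.1 :: A.2).map Prod.snd) (by simp) p.2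
        (List.mem_map_of_mem hp)
      omega
    have hB : ∀ p ∈ B.1 :: B.2, p.2 < H := fun p hp => by
      have := List.single_le_sum (l := (B.1 :: B.2).map Prod.snd) (by simp) p.2
        (List.mem_map_of_mem hp)
      omega
    refine ⟨e, H, D * (e + 1) + 1, hA, hB, Nat.lt_succ_self _, fun g _ => ?_⟩
    rw [GridCondition, or_iff_not_imp_left]
    intro hg
    push Not at hg
    set η : ℝ := 1 / ((e : ℝ) + 1) with hη
    have hg' : ∀ a < H, ∀ b < H, η * (g.getD a 0 : ℕ) - η * (g.getD b 0 : ℕ) ≤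
        dist (s a) (s b) + η := by
      intro a ha b hb
      have := hg a (List.mem_range.2 ha) b (List.mem_range.2 hb)
      push_cast at this
      rw [← hη] at this
      linarith
    obtain ⟨F, hF, hFg⟩ := exists_lipschitz_near s (Nat.succ_pos _)
      (fun a => η * (g.getD a 0 : ℕ)) hg'
    have h1 := integral_sub_le_dist (idealMeasure s A) (idealMeasure s B) hF
    rw [integral_idealMeasure, integral_idealMeasure] at h1
    have h2 : avg (fun i => η * (g.getD i 0 : ℕ)) (A.1 :: A.2) ≤
        avg (fun i => F (s i)) (A.1 :: A.2) + η := by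
      rw [← avg_add_const]
      exact avg_mono fun p hp => (hFg _ (hA p hp)).2
    have h3 : avg (fun i => F (s i)) (B.1 :: B.2) ≤
        avg (fun i => η * (g.getD i 0 : ℕ)) (B.1 :: B.2) :=
      avg_mono fun p hp => (hFg _ (hB p hp)).1
    rw [avg_grid] at h2 h3
    rw [← Rat.cast_lt (K := ℝ)]
    push_cast
    rw [← hη]
    linarith
  · rintro ⟨e, H, M, hA, hB, hM, h⟩
    set η : ℝ := 1 / ((e : ℝ) + 1) with hη
    have hη0 : 0 < η := by positivity
    have hη1 : η * (e + 1) = 1 := by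
      rw [hη]
      field_simp
    -- Rounding costs one of the two `η` in `GridCondition`; the other keeps the inequality strict
    -- after the supremum.
    refine lt_of_le_of_lt (dist_le_of_forall_lipschitz (c := c - η) fun f hf => ?_) (by linarith)
    have : Nonempty X := ⟨s 0⟩
    set m := ⨅ x, f x with hm
    have hbdd : BddBelow (range f) := ⟨f (s 0) - D, by
      rintro _ ⟨x, rfl⟩
      have := (le_abs_self _).trans ((abs_sub_le_diam hf (s 0) x).trans hD)
      linarith⟩
    have hm1 : ∀ x, m ≤ f x := fun x => ciInf_le hbdd x
    have hm2 : ∀ x, f x - D ≤ m := fun x => le_ciInf fun y => by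
      have := (le_abs_self _).trans ((abs_sub_le_diam hf x y).trans hD)
      linarith
    set g : List ℕ := (List.range H).map fun i => ⌊(f (s i) - m) * (e + 1)⌋₊ with hg
    have hgi : ∀ i < H, g.getD i 0 = ⌊(f (s i) - m) * (e + 1)⌋₊ := fun i hi => by
      rw [hg]
      simp [List.getD_eq_getElem?_getD, hi]
    have he0 : (0 : ℝ) < e + 1 := by positivity
    have hg1 : ∀ i < H, η * (g.getD i 0 : ℕ) ≤ f (s i) - m := fun i hi => by
      rw [hgi i hi]
      have := Nat.floor_le (mul_nonneg (sub_nonneg.2 (hm1 (s i))) he0.le)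
      calc _ ≤ η * ((f (s i) - m) * (e + 1)) := mul_le_mul_of_nonneg_left this hη0.le
        _ = (f (s i) - m) * (η * (e + 1)) := by ring
        _ = _ := by rw [hη1, mul_one]
    have hg2 : ∀ i < H, f (s i) - m ≤ η * (g.getD i 0 : ℕ) + η := fun i hi => by
      rw [hgi i hi]
      have := (Nat.lt_floor_add_one ((f (s i) - m) * (e + 1))).le
      calc f (s i) - m = (f (s i) - m) * (η * (e + 1)) := by rw [hη1, mul_one]
        _ = η * ((f (s i) - m) * (e + 1)) := by ring
        _ ≤ η * (⌊(f (s i) - m) * (e + 1)⌋₊ + 1) := mul_le_mul_of_nonneg_left this hη0.le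
        _ = _ := by ring
    have hgmem : g ∈ tuples (List.range M) H := by
      refine mem_tuples.2 ⟨by simp [hg], fun n hn => ?_⟩
      obtain ⟨i, -, rfl⟩ := List.mem_map.1 hn
      rw [List.mem_range, Nat.floor_lt (mul_nonneg (sub_nonneg.2 (hm1 (s i))) he0.le)]
      have h1 := hm2 (s i)
      have h2 : ((D * (e + 1) : ℕ) : ℝ) < M := by exact_mod_cast hM
      push_cast at h2
      nlinarith
    -- The first alternative is impossible: `g` is `f - m` rounded down, so its Lipschitz defect is
    -- at most `η`.
    rcases h g hgmem with ⟨a, ha, b, hb, h1⟩ | h1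
    · exfalso
      rw [List.mem_range] at ha hb
      push_cast at h1
      rw [← hη] at h1
      have h2 := hg1 a ha
      have h3 := hg2 b hb
      have h4 := hf.dist_le_mul (s a) (s b)
      rw [Real.dist_eq, NNReal.coe_one, one_mul] at h4
      have h5 := (le_abs_self _).trans h4
      linarith
    · rw [← Rat.cast_lt (K := ℝ)] at h1
      push_cast at h1
      rw [← hη, ← avg_grid, ← avg_grid] at h1
      rw [integral_idealMeasure, integral_idealMeasure]
      have h2 : avg (fun i => f (s i) - m) (A.1 :: A.2) ≤
          avg (fun i => η * (g.getD i 0 : ℕ) + η) (A.1 :: A.2) :=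
        avg_mono fun p hp => hg2 _ (hA p hp)
      have h3 : avg (fun i => η * (g.getD i 0 : ℕ)) (B.1 :: B.2) ≤
          avg (fun i => f (s i) - m) (B.1 :: B.2) :=
        avg_mono fun p hp => hg1 _ (hB p hp)
      rw [avg_sub_const] at h2 h3
      rw [avg_add_const] at h2
      linarith

end

/-! ### Certifying that ideal measures are far from `V` -/

/-- The total weight of the pairs in `l` whose second component lies in `J`. -/
def weightIn (J : List ℕ) (l : List (ℕ × ℕ)) : ℕ :=
  (l.map fun p => if p.2 ∈ J then p.1 + 1 else 0).sum

theorem weightIn_div (J : List ℕ) (l : List (ℕ × ℕ)) :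
    (weightIn J l : ℝ) / totalWeight l = avg (fun i => if i ∈ J then 1 else 0) l := by
  rw [avg, weightIn]
  congr 1
  induction l with
  | nil => simp
  | cons p l ih =>
    simp only [List.map_cons, List.sum_cons, Nat.cast_add, ih]
    congr 1
    split_ifs <;> simp

/-- A certificate that `‖μ‖_α > K` for all `μ` within `2 / (n + 1)` of the ideal measure named by
`A`. -/
def FarFromV {X : Type*} [MetricSpace X] (s : ℕ → X) (α K : ℝ) (A : CombName) (n : ℕ) : Prop :=
  ∃ (i : ℕ) (r : ℕ × ℕ) (m : ℕ) (J : List ℕ) (v : ℕ × ℕ),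
    K * (posRat r : ℝ) ^ α < posRat v ∧
    posRat v + 2 * (1 / ((n : ℚ) + 1)) * ((m : ℚ) + 1) <
      weightIn J (A.1 :: A.2) / totalWeight (A.1 :: A.2) ∧
    ∀ j ∈ J, dist (s j) (s i) < ((posRat r - 1 / ((m : ℚ) + 1) : ℚ) : ℝ)

section

variable {X : Type*} [MetricSpace X] [MeasurableSpace X] [BorelSpace X]

theorem farFromV_of_lt {s : ℕ → X} {α K : ℝ} (hK : 0 ≤ K) {A : CombName} {n i m : ℕ} {r : ℕ × ℕ}
    (h : K * (posRat r : ℝ) ^ α + 2 * (1 / ((n : ℝ) + 1)) * ((m : ℝ) + 1) <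
      (idealMeasure s A).toMeasure.real (Metric.ball (s i) (posRat r - 1 / ((m : ℝ) + 1)))) :
    FarFromV s α K A n := by
  classical
  obtain ⟨v, hv1, hv2⟩ := exists_rat_btwn (lt_sub_iff_add_lt.2 h)
  have hr0 : (0 : ℝ) < posRat r := by exact_mod_cast posRat_pos r
  have hv0 : (0 : ℝ) < v :=
    lt_of_le_of_lt (mul_nonneg hK (Real.rpow_pos_of_pos hr0 α).le) hv1
  obtain ⟨v, rfl⟩ := exists_posRat_eq (q := v) (by exact_mod_cast hv0)
  set S := Metric.ball (s i) (posRat r - 1 / ((m : ℝ) + 1)) with hS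
  -- `J` collects the support points in the ball. Only its existence matters, so a classical choice
  -- is harmless.
  refine ⟨i, r, m, ((A.1 :: A.2).map Prod.snd).filter fun j => s j ∈ S, v, hv1, ?_, ?_⟩
  · rw [← Rat.cast_lt (K := ℝ)]
    push_cast
    rw [weightIn_div]
    refine lt_of_lt_of_le (lt_sub_iff_add_lt.1 hv2) ?_
    rw [idealMeasure_real s A Metric.isOpen_ball.measurableSet]
    refine avg_mono fun p hp => ?_
    by_cases hpS : s p.2 ∈ S
    · rw [if_pos (List.mem_filter.2 ⟨List.mem_map_of_mem hp, by simpa using hpS⟩)]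
      exact indicator_le_self' (fun _ _ => zero_le_one) _
    · rw [indicator_of_notMem hpS]
      split_ifs <;> norm_num
  · intro j hj
    have : s j ∈ S := by simpa using (List.mem_filter.1 hj).2
    push_cast
    exact this

/-- By `real_ball_le` with `δ = 1 / (m + 1)`, passing to `μ` loses at most `2 / (n + 1) * (m + 1)`
of mass, exactly the margin in the certificate. -/
theorem FarFromV.notMem_V [BoundedSpace X] {s : ℕ → X} {α K : ℝ} (hK : 0 ≤ K) {A : CombName} {n : ℕ}
    (h : FarFromV s α K A n) {μ : PM X} (hμ : dist μ (idealMeasure s A) ≤ 2 * (1 / ((n : ℝ) + 1))) :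
    μ ∉ V X α K := by
  obtain ⟨i, r, m, J, v, h1, h2, h3⟩ := h
  have hm0 : (0 : ℝ) < m + 1 := by positivity
  rw [mem_V_iff hK]
  push Not
  refine ⟨s i, posRat r, by exact_mod_cast posRat_pos r, ?_⟩
  rw [← Rat.cast_lt (K := ℝ)] at h2
  push_cast at h2
  rw [weightIn_div] at h2
  have h4 := real_ball_le μ (idealMeasure s A) (s i) (posRat r - 1 / ((m : ℝ) + 1))
    (δ := 1 / ((m : ℝ) + 1)) (by positivity)
  rw [sub_add_cancel, idealMeasure_real s A Metric.isOpen_ball.measurableSet] at h4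
  have h5 : avg (fun i => if i ∈ J then (1 : ℝ) else 0) (A.1 :: A.2) ≤
      avg (fun j => (Metric.ball (s i) (posRat r - 1 / ((m : ℝ) + 1))).indicator
        (fun _ => (1 : ℝ)) (s j)) (A.1 :: A.2) := by
    refine avg_mono fun p _ => ?_
    split_ifs with hp
    · have := h3 _ hp
      push_cast at this
      rw [indicator_of_mem (Metric.mem_ball.2 this)]
    · exact indicator_nonneg (fun _ _ => zero_le_one) _
  have h6 : dist (idealMeasure s A) μ / (1 / ((m : ℝ) + 1)) ≤
      2 * (1 / ((n : ℝ) + 1)) * ((m : ℝ) + 1) := by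
    rw [div_div_eq_mul_div, div_one, dist_comm]
    exact mul_le_mul_of_nonneg_right hμ hm0.le
  linarith

end

end CompMeas

namespace CompMeas

open MeasureTheory Set Filter Topology
open scoped ENNReal NNReal

/-! ### Computability of the tests -/

attribute [local irreducible] REPred

section

variable {α β : Type*} [Primcodable α] [Primcodable β]

theorem primrec_list_sum_map {l : α → List β} {g : α → β → ℕ} (hl : Primrec l)
    (hg : Primrec₂ g) : Primrec fun a => ((l a).map (g a)).sum := by
  have h : Primrec fun L : List ℕ => L.sum :=
    (Primrec.list_foldr (f := fun L : List ℕ => L) (g := fun _ => 0)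
      (h := fun _ (x : ℕ × ℕ) => x.1 + x.2) Primrec.id (Primrec.const 0)
      (Primrec.nat_add.comp (Primrec.fst.comp Primrec.snd)
        (Primrec.snd.comp Primrec.snd))).of_eq fun L => rfl
  exact h.comp (Primrec.list_map hl hg)

theorem primrec_totalWeight : Primrec totalWeight :=
  primrec_list_sum_map Primrec.id (Primrec.succ.comp (Primrec.fst.comp Primrec.snd))

theorem primrec_tuples : Primrec₂ tuples := by
  refine Primrec.nat_iterate Primrec.snd (Primrec.const _) ?_
  refine Primrec.list_flatMap Primrec.snd (Primrec.list_map
    (Primrec.fst.comp (Primrec.fst.comp Primrec.fst)) ?_)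
  exact Primrec.list_cons.comp Primrec.snd (Primrec.snd.comp Primrec.fst)

theorem primrec_gridSum : Primrec₂ gridSum := by
  refine primrec_list_sum_map Primrec.snd ?_
  exact Primrec.nat_mul.comp (Primrec.succ.comp (Primrec.fst.comp Primrec.snd))
    ((Primrec.list_getD 0).comp (Primrec.fst.comp Primrec.fst) (Primrec.snd.comp Primrec.snd))

theorem primrec_weightIn : Primrec₂ weightIn := by
  refine primrec_list_sum_map Primrec.snd ?_
  exact Primrec.ite (primrecPred_mem_list (Primrec.snd.comp Primrec.snd)
    (Primrec.fst.comp Primrec.fst)) (Primrec.succ.comp (Primrec.fst.comp Primrec.snd))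
    (Primrec.const 0)

theorem primrec_listOfName : Primrec fun A : CombName => A.1 :: A.2 :=
  Primrec.list_cons.comp Primrec.fst Primrec.snd

theorem primrec_uniformName : Primrec₂ uniformName :=
  Primrec.pair (Primrec.pair (Primrec.const 0) Primrec.fst)
    (Primrec.list_map Primrec.snd (Primrec.pair (Primrec.const 0) Primrec.snd))

theorem UnifUpperSemicomputable.rePred_lt {x : β → ℝ} (hx : UnifUpperSemicomputable x)
    {k : α → β} (hk : Primrec k) {f : α → ℚ} (hf : PrimrecRat f) :
    REPred fun a => x (k a) < f a := by
  obtain ⟨g, hg, e⟩ := hf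
  refine (rePred_comp hx (hk.pair hg)).of_eq fun a => ?_
  rw [e]

theorem rePred_mul_rpow_lt {a K : ℝ} (ha : ComputableReal a) (hK : UpperSemicomputable K)
    (hK0 : 0 ≤ K) :
    REPred fun x : (ℕ × ℕ) × (ℕ × ℕ) => K * (posRat x.1 : ℝ) ^ a < posRat x.2 := by
  have hpow : REPred fun x : (ℕ × ℕ) × (ℕ × ℕ × ℕ) × (ℕ × ℕ) =>
      (posRat x.1 : ℝ) ^ (rat x.2.1 : ℝ) < posRat x.2.2 := by
    have hr := primrecRat_posRat (Primrec.fst (α := ℕ × ℕ) (β := (ℕ × ℕ × ℕ) × (ℕ × ℕ)))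
    have hq := Primrec.fst.comp (Primrec.snd (α := ℕ × ℕ) (β := (ℕ × ℕ × ℕ) × (ℕ × ℕ)))
    have hu := primrecRat_posRat
      (Primrec.snd.comp (Primrec.snd (α := ℕ × ℕ) (β := (ℕ × ℕ × ℕ) × (ℕ × ℕ))))
    refine (rePred_of_primrecPred ((hr.pow (Primrec.fst.comp hq)).lt
      ((hu.pow (Primrec.succ.comp (Primrec.snd.comp (Primrec.snd.comp hq)))).mul
        (hr.pow (Primrec.fst.comp (Primrec.snd.comp hq)))))).of_eq fun x => ?_
    exact (rpow_rat_lt_iff (posRat_pos _) (posRat_pos _) _).symm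
  have h : REPred fun x : (ℕ × ℕ) × (ℕ × ℕ) =>
      ∃ y : (ℕ × ℕ × ℕ) × (ℕ × ℕ) × (ℕ × ℕ × ℕ) × (ℕ × ℕ × ℕ),
        K < rat y.1 ∧ rat y.2.2.1 < a ∧ a < rat y.2.2.2 ∧
        (posRat x.1 : ℝ) ^ (rat y.2.2.1 : ℝ) < posRat y.2.1 ∧
        (posRat x.1 : ℝ) ^ (rat y.2.2.2 : ℝ) < posRat y.2.1 ∧
        rat y.1 * posRat y.2.1 < posRat x.2 := by
    refine rePred_exists ?_
    have k := Primrec.fst.comp (Primrec.snd (α := (ℕ × ℕ) × (ℕ × ℕ))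
      (β := (ℕ × ℕ × ℕ) × (ℕ × ℕ) × (ℕ × ℕ × ℕ) × (ℕ × ℕ × ℕ)))
    have u := Primrec.fst.comp (Primrec.snd.comp (Primrec.snd (α := (ℕ × ℕ) × (ℕ × ℕ))
      (β := (ℕ × ℕ × ℕ) × (ℕ × ℕ) × (ℕ × ℕ × ℕ) × (ℕ × ℕ × ℕ))))
    have qq := Primrec.snd.comp (Primrec.snd.comp (Primrec.snd (α := (ℕ × ℕ) × (ℕ × ℕ))
      (β := (ℕ × ℕ × ℕ) × (ℕ × ℕ) × (ℕ × ℕ × ℕ) × (ℕ × ℕ × ℕ))))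
    have r := Primrec.fst.comp (Primrec.fst (α := (ℕ × ℕ) × (ℕ × ℕ))
      (β := (ℕ × ℕ × ℕ) × (ℕ × ℕ) × (ℕ × ℕ × ℕ) × (ℕ × ℕ × ℕ)))
    have v := Primrec.snd.comp (Primrec.fst (α := (ℕ × ℕ) × (ℕ × ℕ))
      (β := (ℕ × ℕ × ℕ) × (ℕ × ℕ) × (ℕ × ℕ × ℕ) × (ℕ × ℕ × ℕ)))
    have h1 := rePred_comp hK k
    have h2 := rePred_comp ha.1 (Primrec.fst.comp qq)
    have h3 := rePred_comp ha.2 (Primrec.snd.comp qq)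
    have h4 := rePred_comp hpow (r.pair ((Primrec.fst.comp qq).pair u))
    have h5 := rePred_comp hpow (r.pair ((Primrec.snd.comp qq).pair u))
    have h6 := rePred_of_primrecPred
      (((primrecRat_rat k).mul (primrecRat_posRat u)).lt (primrecRat_posRat v))
    exact rePred_and h1 (rePred_and h2 (rePred_and h3 (rePred_and h4 (rePred_and h5 h6))))
  refine h.of_eq fun x => ?_
  rw [mul_rpow_lt_iff hK0 (by exact_mod_cast posRat_pos x.1)]
  constructor
  · rintro ⟨⟨k, u, q, q'⟩, h1, h2, h3, h4, h5, h6⟩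
    exact ⟨k, u, q, q', h1, h2, h3, h4, h5, by exact_mod_cast h6⟩
  · rintro ⟨k, u, q, q', h1, h2, h3, h4, h5, h6⟩
    exact ⟨⟨k, u, q, q'⟩, h1, h2, h3, h4, h5, by exact_mod_cast h6⟩

end

/-! ### Enumerability of the tests on ideal measures and of the cover certificates. -/

section

variable {X : Type*} [MetricSpace X] {s : ℕ → X}

theorem rePred_gridCondition
    (hs : UnifUpperSemicomputable fun p : ℕ × ℕ => dist (s p.1) (s p.2)) :
    REPred fun x : ((CombName × CombName) × (ℕ × ℕ × ℕ)) × (ℕ × ℕ) × List ℕ =>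
      GridCondition s x.1.1.1 x.1.1.2 (rat x.1.2) x.2.1.1 x.2.1.2 x.2.2 := by
  refine rePred_or ?_ ?_
  · refine rePred_exists_mem_list (Primrec.list_range.comp
      (Primrec.snd.comp (Primrec.fst.comp Primrec.snd))) ?_
    refine rePred_exists_mem_list (Primrec.list_range.comp
      (Primrec.snd.comp (Primrec.fst.comp (Primrec.snd.comp Primrec.fst)))) ?_
    have hx := Primrec.fst.comp (Primrec.fst
      (α := (((CombName × CombName) × (ℕ × ℕ × ℕ)) × (ℕ × ℕ) × List ℕ) × ℕ) (β := ℕ))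
    have ha := Primrec.snd.comp (Primrec.fst
      (α := (((CombName × CombName) × (ℕ × ℕ × ℕ)) × (ℕ × ℕ) × List ℕ) × ℕ) (β := ℕ))
    have hb := Primrec.snd
      (α := (((CombName × CombName) × (ℕ × ℕ × ℕ)) × (ℕ × ℕ) × List ℕ) × ℕ) (β := ℕ)
    have hg := Primrec.snd.comp (Primrec.snd.comp hx)
    have hη := primrecRat_inv_succ (Primrec.fst.comp (Primrec.fst.comp (Primrec.snd.comp hx)))
    exact UnifUpperSemicomputable.rePred_lt hs (ha.pair hb)
      ((hη.mul ((primrecRat_natCast ((Primrec.list_getD 0).comp hg ha)).sub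
        (primrecRat_natCast ((Primrec.list_getD 0).comp hg hb)))).sub hη)
  · have hx := Primrec.fst
      (α := (CombName × CombName) × (ℕ × ℕ × ℕ)) (β := (ℕ × ℕ) × List ℕ)
    have hy := Primrec.snd
      (α := (CombName × CombName) × (ℕ × ℕ × ℕ)) (β := (ℕ × ℕ) × List ℕ)
    have hg := Primrec.snd.comp hy
    have hη := primrecRat_inv_succ (Primrec.fst.comp (Primrec.fst.comp hy))
    have hA := primrec_listOfName.comp (Primrec.fst.comp (Primrec.fst.comp hx))
    have hB := primrec_listOfName.comp (Primrec.snd.comp (Primrec.fst.comp hx))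
    exact rePred_of_primrecPred (((hη.mul ((primrecRat_natCast
      (primrec_gridSum.comp hg hA)).div_natCast (primrec_totalWeight.comp hA))).sub
      (hη.mul ((primrecRat_natCast
      (primrec_gridSum.comp hg hB)).div_natCast (primrec_totalWeight.comp hB)))).lt
      ((primrecRat_rat (Primrec.snd.comp hx)).sub ((primrecRat_two).mul hη)))

theorem primrecPred_forall_snd_lt :
    PrimrecPred fun x : List (ℕ × ℕ) × ℕ => ∀ p ∈ x.1, p.2 < x.2 := by
  have h : PrimrecRel fun (p : ℕ × ℕ) (H : ℕ) => p.2 < H :=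
    Primrec.nat_lt.comp (Primrec.snd.comp Primrec.fst) Primrec.snd
  exact h.forall_mem_list.comp Primrec.fst Primrec.snd

theorem unifUpperSemicomputable_dist_idealMeasure [BoundedSpace X] [MeasurableSpace X]
    [BorelSpace X] (hs : UnifUpperSemicomputable fun p : ℕ × ℕ => dist (s p.1) (s p.2)) :
    UnifUpperSemicomputable fun p : CombName × CombName =>
      dist (idealMeasure s p.1) (idealMeasure s p.2) := by
  -- `D` is one constant built into the algorithm; it need not be computed from anything.
  obtain ⟨D, hD⟩ := exists_nat_ge (Metric.diam (univ : Set X))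
  have h : REPred fun x : (CombName × CombName) × (ℕ × ℕ × ℕ) => ∃ y : (ℕ × ℕ) × ℕ,
      (∀ p ∈ x.1.1.1 :: x.1.1.2, p.2 < y.1.2) ∧ (∀ p ∈ x.1.2.1 :: x.1.2.2, p.2 < y.1.2) ∧
      D * (y.1.1 + 1) < y.2 ∧ ∀ g ∈ tuples (List.range y.2) y.1.2,
        GridCondition s x.1.1 x.1.2 (rat x.2) y.1.1 y.1.2 g := by
    refine rePred_exists ?_
    have hx := Primrec.fst (α := (CombName × CombName) × (ℕ × ℕ × ℕ)) (β := (ℕ × ℕ) × ℕ)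
    have hM := Primrec.snd.comp
      (Primrec.snd (α := (CombName × CombName) × (ℕ × ℕ × ℕ)) (β := (ℕ × ℕ) × ℕ))
    have he := Primrec.fst.comp (Primrec.fst.comp
      (Primrec.snd (α := (CombName × CombName) × (ℕ × ℕ × ℕ)) (β := (ℕ × ℕ) × ℕ)))
    have hH := Primrec.snd.comp (Primrec.fst.comp
      (Primrec.snd (α := (CombName × CombName) × (ℕ × ℕ × ℕ)) (β := (ℕ × ℕ) × ℕ)))
    have hA := primrec_listOfName.comp (Primrec.fst.comp (Primrec.fst.comp hx))
    have hB := primrec_listOfName.comp (Primrec.snd.comp (Primrec.fst.comp hx))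
    refine rePred_and (rePred_of_primrecPred (primrecPred_forall_snd_lt.comp (hA.pair hH))) <|
      rePred_and (rePred_of_primrecPred (primrecPred_forall_snd_lt.comp (hB.pair hH))) <|
      rePred_and (rePred_of_primrecPred (Primrec.nat_lt.comp
        (Primrec.nat_mul.comp (Primrec.const D) (Primrec.succ.comp he)) hM)) <|
      rePred_forall_mem_list (primrec_tuples.comp (Primrec.list_range.comp hM) hH) ?_
    exact rePred_comp (rePred_gridCondition hs) ((hx.comp Primrec.fst).pair
      (((he.comp Primrec.fst).pair (hH.comp Primrec.fst)).pair Primrec.snd))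
  refine h.of_eq fun x => ?_
  rw [dist_idealMeasure_lt_iff s hD]
  constructor
  · rintro ⟨⟨⟨e, H⟩, M⟩, h⟩
    exact ⟨e, H, M, h⟩
  · rintro ⟨e, H, M, h⟩
    exact ⟨⟨⟨e, H⟩, M⟩, h⟩

theorem rePred_farFromV (hs : UnifUpperSemicomputable fun p : ℕ × ℕ => dist (s p.1) (s p.2))
    {a K : ℝ} (ha : ComputableReal a) (hK : UpperSemicomputable K) (hK0 : 0 ≤ K) :
    REPred fun x : CombName × ℕ => FarFromV s a K x.1 x.2 := by
  have h : REPred fun x : CombName × ℕ =>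
      ∃ y : (ℕ × ℕ) × (ℕ × ℕ) × List ℕ × (ℕ × ℕ),
        K * (posRat y.2.1 : ℝ) ^ a < posRat y.2.2.2 ∧
        posRat y.2.2.2 + 2 * (1 / ((x.2 : ℚ) + 1)) * ((y.1.2 : ℚ) + 1) <
          weightIn y.2.2.1 (x.1.1 :: x.1.2) / totalWeight (x.1.1 :: x.1.2) ∧
        ∀ j ∈ y.2.2.1, dist (s j) (s y.1.1) <
          ((posRat y.2.1 - 1 / ((y.1.2 : ℚ) + 1) : ℚ) : ℝ) := by
    refine rePred_exists ?_
    have hx := Primrec.fst (α := CombName × ℕ) (β := (ℕ × ℕ) × (ℕ × ℕ) × List ℕ × (ℕ × ℕ))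
    have hy := Primrec.snd (α := CombName × ℕ) (β := (ℕ × ℕ) × (ℕ × ℕ) × List ℕ × (ℕ × ℕ))
    have hi := Primrec.fst.comp (Primrec.fst.comp hy)
    have hm := Primrec.snd.comp (Primrec.fst.comp hy)
    have hr := Primrec.fst.comp (Primrec.snd.comp hy)
    have hJ := Primrec.fst.comp (Primrec.snd.comp (Primrec.snd.comp hy))
    have hv := Primrec.snd.comp (Primrec.snd.comp (Primrec.snd.comp hy))
    have hA := primrec_listOfName.comp (Primrec.fst.comp hx)
    have h1 := rePred_comp (rePred_mul_rpow_lt ha hK hK0) (hr.pair hv)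
    have h2 := rePred_of_primrecPred (((primrecRat_posRat hv).add ((primrecRat_two.mul
      (primrecRat_inv_succ (Primrec.snd.comp hx))).mul (primrecRat_natCast_add_one hm))).lt
        ((primrecRat_natCast (primrec_weightIn.comp hJ hA)).div_natCast
          (primrec_totalWeight.comp hA)))
    have h3 := UnifUpperSemicomputable.rePred_lt hs (Primrec.snd.pair (hi.comp Primrec.fst))
      (((primrecRat_posRat hr).sub (primrecRat_inv_succ hm)).comp
        (Primrec.fst (α := (CombName × ℕ) × (ℕ × ℕ) × (ℕ × ℕ) × List ℕ × (ℕ × ℕ)) (β := ℕ)))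
    exact rePred_and h1 (rePred_and h2 (rePred_forall_mem_list hJ h3))
  refine h.of_eq fun x => ?_
  constructor
  · rintro ⟨⟨⟨i, m⟩, r, J, v⟩, h1, h2, h3⟩
    exact ⟨i, r, m, J, v, h1, h2, h3⟩
  · rintro ⟨i, r, m, J, v, h1, h2, h3⟩
    exact ⟨⟨⟨i, m⟩, r, J, v⟩, h1, h2, h3⟩

/-- A finite certificate that the ideal balls in `L` cover `V`: a finite `2 / (n + 1)`-net of
ideal measures all of whose members are deep inside a ball or far from `V`. -/
def CoverCertificate [BoundedSpace X] [MeasurableSpace X] [BorelSpace X] (s : ℕ → X) (D : ℕ)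
    (a K : ℝ) (L : List (CombName × (ℕ × ℕ))) (n : ℕ) (l : List ℕ) (N : ℕ) : Prop :=
  (univ : Set X) ⊆ ⋃ p ∈ l.map fun i => (i, ((0, n) : ℕ × ℕ)), idealBall s p ∧
  D * l.length * (n + 1) < N + 2 ∧
  ∀ i ∈ l, ∀ t ∈ tuples l N,
    (∃ p ∈ L, dist (idealMeasure s (uniformName i t)) (idealMeasure s p.1) <
      ((posRat p.2 - 2 * (1 / ((n : ℚ) + 1)) : ℚ) : ℝ)) ∨
    FarFromV s a K (uniformName i t) n

theorem univ_subset_idealBall_iff (s : ℕ → X) (l : List ℕ) (n : ℕ) :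
    ((univ : Set X) ⊆ ⋃ p ∈ l.map fun i => (i, ((0, n) : ℕ × ℕ)), idealBall s p) ↔
      ∀ x, ∃ i ∈ l, x ∈ Metric.ball (s i) (1 / ((n : ℝ) + 1)) := by
  simp [subset_def, idealBall, posRat]

/-- Existence is a compactness argument by contradiction; soundness is the net property and the
triangle inequality. -/
theorem subset_iUnion_iff_exists_coverCertificate [BoundedSpace X] [MeasurableSpace X]
    [BorelSpace X] (hs : DenseRange s) (hX : IsCompact (univ : Set X)) {D : ℕ}
    (hD : Metric.diam (univ : Set X) ≤ D) {a K : ℝ} (hK : 0 ≤ K)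
    (L : List (CombName × (ℕ × ℕ))) :
    (V X a K ⊆ ⋃ p ∈ L, idealBall (idealMeasure s) p) ↔
      ∃ n l N, CoverCertificate s D a K L n l N := by
  constructor
  · intro h
    by_contra hcon
    -- A net of `X` and a long enough tuple length exist at every scale, so a missing certificate
    -- can only be due to a bad ideal measure.
    have hfail : ∀ n : ℕ, ∃ A : CombName,
        (∀ p ∈ L, (posRat p.2 : ℝ) - 2 * (1 / ((n : ℝ) + 1)) ≤
          dist (idealMeasure s A) (idealMeasure s p.1)) ∧ ¬ FarFromV s a K A n := by
      intro n
      obtain ⟨l, hl⟩ := exists_list_cover s hs hX (ε := 1 / ((n : ℝ) + 1)) (by positivity)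
      by_contra hA
      push Not at hA
      refine hcon ⟨n, l, D * l.length * (n + 1), (univ_subset_idealBall_iff s l n).2 hl,
        by omega, fun i _ t _ => ?_⟩
      rw [or_iff_not_imp_left]
      intro hp
      push Not at hp
      exact hA _ fun p hpL => by simpa using hp p hpL
    choose A hA hAV using hfail
    have := compactSpace_PM s hs hX
    obtain ⟨μ, φ, hφ, hμ⟩ := CompactSpace.tendsto_subseq fun n => idealMeasure s (A n)
    have hε : Tendsto (fun n => 1 / ((φ n : ℝ) + 1)) atTop (𝓝 0) :=
      tendsto_one_div_add_atTop_nhds_zero_nat.comp hφ.tendsto_atTop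
    have hdist : Tendsto (fun n => dist (idealMeasure s (A (φ n))) μ) atTop (𝓝 0) :=
      tendsto_iff_dist_tendsto_zero.1 hμ
    have hμV : μ ∉ V X a K := by
      intro hV
      obtain ⟨p, hp, hμp⟩ : ∃ p ∈ L, μ ∈ idealBall (idealMeasure s) p := by
        simpa using h hV
      have h1 : (posRat p.2 : ℝ) - 2 * 0 ≤ dist μ (idealMeasure s p.1) :=
        le_of_tendsto_of_tendsto' (tendsto_const_nhds.sub (hε.const_mul 2))
          (hμ.dist tendsto_const_nhds) fun n => hA (φ n) p hp
      have h2 : dist μ (idealMeasure s p.1) < posRat p.2 := hμp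
      linarith
    obtain ⟨i, r, m, hlt⟩ := exists_ideal_ball_of_notMem_V hs hK hμV
    -- Both error terms, the certificate margin and the loss in replacing `μ` by `A (φ n)`, vanish
    -- for fixed `m`, so the strict excess eventually survives.
    have hlim : Tendsto (fun n => K * (posRat r : ℝ) ^ a +
        2 * (1 / ((φ n : ℝ) + 1)) * ((m : ℝ) + 1) +
        dist (idealMeasure s (A (φ n))) μ / (1 / ((m : ℝ) + 1))) atTop
        (𝓝 (K * (posRat r : ℝ) ^ a + 2 * 0 * ((m : ℝ) + 1) + 0 / (1 / ((m : ℝ) + 1)))) :=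
      (tendsto_const_nhds.add ((hε.const_mul 2).mul_const _)).add (hdist.div_const _)
    obtain ⟨n, hn⟩ := (hlim.eventually (gt_mem_nhds (by
      rwa [mul_zero, zero_mul, zero_div, add_zero, add_zero]))).exists
    refine hAV (φ n) (farFromV_of_lt (i := i) (r := r) (m := m) hK ?_)
    have h3 := real_ball_le (idealMeasure s (A (φ n))) μ (s i)
      (posRat r - 2 * (1 / ((m : ℝ) + 1))) (δ := 1 / ((m : ℝ) + 1)) (by positivity)
    rw [show (posRat r : ℝ) - 2 * (1 / ((m : ℝ) + 1)) + 1 / ((m : ℝ) + 1) =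
      posRat r - 1 / ((m : ℝ) + 1) by ring, dist_comm] at h3
    linarith
  · rintro ⟨n, l, N, hl, hN, h⟩ μ hμ
    rw [univ_subset_idealBall_iff] at hl
    -- The bound `< N + 2` is `≤ N + 1`, the number of points in a tuple with its head.
    have hN' : (D : ℝ) * l.length ≤ (N + 1) * (1 / ((n : ℝ) + 1)) := by
      rw [mul_one_div, le_div_iff₀ (by positivity)]
      exact_mod_cast Nat.lt_succ_iff.1 hN
    obtain ⟨i, hi, t, ht, hd⟩ := exists_uniformName_dist_le s hD hl hN' μ
    rcases h i hi t ht with ⟨p, hp, hlt⟩ | hfar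
    · refine mem_iUnion₂.2 ⟨p, hp, ?_⟩
      push_cast at hlt
      have := dist_triangle μ (idealMeasure s (uniformName i t)) (idealMeasure s p.1)
      exact Metric.mem_ball.2 (by linarith)
    · exact absurd hμ (hfar.notMem_V hK hd)

theorem rePred_deepInBall_or_farFromV [BoundedSpace X] [MeasurableSpace X] [BorelSpace X]
    (hs : UnifUpperSemicomputable fun p : ℕ × ℕ => dist (s p.1) (s p.2))
    {a K : ℝ} (ha : ComputableReal a) (hK : UpperSemicomputable K) (hK0 : 0 ≤ K) :
    REPred fun x : (List (CombName × (ℕ × ℕ)) × ℕ) × CombName =>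
      (∃ p ∈ x.1.1, dist (idealMeasure s x.2) (idealMeasure s p.1) <
        ((posRat p.2 - 2 * (1 / ((x.1.2 : ℚ) + 1)) : ℚ) : ℝ)) ∨ FarFromV s a K x.2 x.1.2 := by
  have hL := Primrec.fst.comp
    (Primrec.fst (α := List (CombName × (ℕ × ℕ)) × ℕ) (β := CombName))
  have hn := Primrec.snd.comp
    (Primrec.fst (α := List (CombName × (ℕ × ℕ)) × ℕ) (β := CombName))
  have hA := Primrec.snd (α := List (CombName × (ℕ × ℕ)) × ℕ) (β := CombName)
  have hp := Primrec.snd (α := (List (CombName × (ℕ × ℕ)) × ℕ) × CombName)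
    (β := CombName × (ℕ × ℕ))
  have h3 := UnifUpperSemicomputable.rePred_lt (unifUpperSemicomputable_dist_idealMeasure hs)
    ((hA.comp Primrec.fst).pair (Primrec.fst.comp hp))
    ((primrecRat_posRat (Primrec.snd.comp hp)).sub (primrecRat_two.mul
      (primrecRat_inv_succ (hn.comp Primrec.fst))))
  have h4 := rePred_comp (rePred_farFromV hs ha hK hK0) (hA.pair hn)
  exact rePred_or (rePred_exists_mem_list
    (p := fun (x : (List (CombName × (ℕ × ℕ)) × ℕ) × CombName) (p : CombName × (ℕ × ℕ)) =>
    dist (idealMeasure s x.2) (idealMeasure s p.1) <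
      ((posRat p.2 - 2 * (1 / ((x.1.2 : ℚ) + 1)) : ℚ) : ℝ)) hL h3) h4

theorem rePred_coverCertificate [BoundedSpace X] [MeasurableSpace X] [BorelSpace X]
    (hs : UnifUpperSemicomputable fun p : ℕ × ℕ => dist (s p.1) (s p.2))
    (hX : IsRecursivelyCompact s (univ : Set X)) (D : ℕ) {a K : ℝ} (ha : ComputableReal a)
    (hK : UpperSemicomputable K) (hK0 : 0 ≤ K) :
    REPred fun x : List (CombName × (ℕ × ℕ)) × (ℕ × List ℕ × ℕ) =>
      CoverCertificate s D a K x.1 x.2.1 x.2.2.1 x.2.2.2 := by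
  have hL := Primrec.fst (α := List (CombName × (ℕ × ℕ))) (β := ℕ × List ℕ × ℕ)
  have hy := Primrec.snd (α := List (CombName × (ℕ × ℕ))) (β := ℕ × List ℕ × ℕ)
  have hn := Primrec.fst.comp hy
  have hl := Primrec.fst.comp (Primrec.snd.comp hy)
  have hN := Primrec.snd.comp (Primrec.snd.comp hy)
  have h1 := rePred_comp hX.2 (Primrec.list_map hl (g := fun x i => (i, ((0, x.2.1) : ℕ × ℕ)))
    (Primrec.snd.pair ((Primrec.const 0).pair (hn.comp Primrec.fst))))
  have h2 := rePred_of_primrecPred (Primrec.nat_lt.comp (Primrec.nat_mul.comp (Primrec.nat_mul.comp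
    (Primrec.const D) (Primrec.list_length.comp hl)) (Primrec.succ.comp hn))
      (Primrec.succ.comp (Primrec.succ.comp hN)))
  have hz := Primrec.fst.comp (Primrec.fst
    (α := (List (CombName × (ℕ × ℕ)) × (ℕ × List ℕ × ℕ)) × ℕ) (β := List ℕ))
  have hU := primrec_uniformName.comp (Primrec.snd.comp Primrec.fst) (Primrec.snd
    (α := (List (CombName × (ℕ × ℕ)) × (ℕ × List ℕ × ℕ)) × ℕ) (β := List ℕ))
  have h3 := rePred_comp (rePred_deepInBall_or_farFromV hs ha hK hK0)
    (((hL.comp hz).pair (hn.comp hz)).pair hU)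
  have h4 := rePred_forall_mem_list (p := fun
    (x : (List (CombName × (ℕ × ℕ)) × (ℕ × List ℕ × ℕ)) × ℕ) (t : List ℕ) =>
    (∃ p ∈ x.1.1, dist (idealMeasure s (uniformName x.2 t)) (idealMeasure s p.1) <
      ((posRat p.2 - 2 * (1 / ((x.1.2.1 : ℚ) + 1)) : ℚ) : ℝ)) ∨
    FarFromV s a K (uniformName x.2 t) x.1.2.1) ((primrec_tuples.comp hl hN).comp Primrec.fst) h3
  exact rePred_and h1 (rePred_and h2 (rePred_forall_mem_list hl h4))

end

end CompMeas

theorem proposition4p3 {X : Type*} [MetricSpace X] [BoundedSpace X] [MeasurableSpace X]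
    [BorelSpace X] (s : ℕ → X) (hs : CompMeas.IsComputableMetricSpace s)
    (hX : CompMeas.IsRecursivelyCompact s (Set.univ : Set X))
    (α K : ℝ) (hα : CompMeas.ComputableReal α) (hK : CompMeas.UpperSemicomputable K) :
    CompMeas.IsRecursivelyCompact (CompMeas.idealMeasure s) (CompMeas.V X α K) := by
  open CompMeas in
  -- The sign of the fixed real `K` need not be decided effectively: each case has its own
  -- algorithm. For `K < 0` every list covers the empty `V`.
  rcases lt_or_ge K 0 with h0 | h0
  · rw [V_eq_empty h0]
    have h : PrimrecPred fun _ : List (CombName × (ℕ × ℕ)) => True :=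
      ⟨fun _ => isTrue trivial, Primrec.const true⟩
    exact ⟨isCompact_empty, (rePred_of_primrecPred h).of_eq fun L => by simp⟩
  · have := compactSpace_PM s hs.dense hX.1
    obtain ⟨D, hD⟩ := exists_nat_ge (Metric.diam (Set.univ : Set X))
    have h : REPred fun L : List (CombName × (ℕ × ℕ)) =>
        ∃ y : ℕ × List ℕ × ℕ, CoverCertificate s D α K L y.1 y.2.1 y.2.2 :=
      rePred_exists (rePred_coverCertificate hs.dist_computable.2 hX D hα hK h0)
    refine ⟨(isClosed_V h0).isCompact, h.of_eq fun L => ?_⟩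
    rw [subset_iUnion_iff_exists_coverCertificate hs.dense hX.1 hD h0]
    exact ⟨fun ⟨⟨n, l, N⟩, h⟩ => ⟨n, l, N, h⟩, fun ⟨n, l, N, h⟩ => ⟨⟨n, l, N⟩, h⟩⟩
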